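/- Let $k$ be a $\sigma$-field, i.e. a field with a ring endomorphism $\sigma\colon k\to k$. A $k$-$\sigma$-algebra is a commutative $k$-algebra $R$ with a ring endomorphism $\sigma\colon R\to R$ (not necessarily injective) extending $\sigma\colon k\to k$ in the sense that $k\to R$ commutes with $\sigma$; morphisms are $k$-algebra morphisms commuting with $\sigma$. A $\sigma$-variety over $k$ is a functor $X$ from $k$-$\sigma$-algebras to sets that is representable by a finitely $\sigma$-generated $k$-$\sigma$-algebra $k\{X\}$. A $\sigma$-closed $\sigma$-subvariety of $X$ is a subfunctor of the form $R\rightsquigarrow\{\psi\in X(R)=\operatorname{Hom}(k\{X\},R)\mid \psi(\mathfrak a)=0\}$ for an ideal $\mathfrak a\subseteq k\{X\}$ with $\sigma(\mathfrak a)\subseteq\mathfrak a$. A $\sigma$-algebraic group $G$ over $k$ is a functor from $k$-$\sigma$-algebras to groups whose underlying set-valued functor is a $\sigma$-variety, and a $\sigma$-closed subgroup $H\le G$ is a $\sigma$-closed $\sigma$-subvariety such that $H(R)$ is a subgroup of $G(R)$ for every $R$. For a finite dimensional $k$-vector space $V$, let $\operatorname{GL}(V)$ be the functor sending $R$ to the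 group of $R$-linear automorphisms of $V\otimes_k R$. A representation of $G$ is such a $V$ together with a morphism $\phi\colon G\to\operatorname{GL}(V)$ of group-valued functors; it is faithful if $\phi$ is a $\sigma$-closed embedding, i.e. induces an isomorphism of $G$ with a $\sigma$-closed $\sigma$-subvariety of $\operatorname{GL}(V)$. **Theorem.** Let $G$ be a $\sigma$-algebraic group over $k$ and let $H\le G$ be a $\sigma$-closed subgroup. Then there exist a faithful representation $V$ of $G$ and a line $L\le V$ (i.e. a one-dimensional $k$-subspace) such that $H$ is the stabilizer of $L$, i.e. $$H(R)=\{g\in G(R)\mid g(L\otimes_k R)\subseteq L\otimes_k R\}$$ for every $k$-$\sigma$-algebra $R$. -/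

import Mathlib

open CategoryTheory TensorProduct

universe u

/-- A `k`-`σ`-algebra over the difference ring `(k, σ)`: a commutative `k`-algebra `R` with a ring
endomorphism of `R` (not necessarily injective) such that `k → R` commutes with the endomorphisms.
-/
structure SigmaAlg (k : Type u) [CommRing k] (σ : k →+* k) where
  carrier : Type u
  [commRing : CommRing carrier]
  [algebra : Algebra k carrier]
  sig : carrier →+* carrier
  sig_algebraMap : ∀ a : k, sig (algebraMap k carrier a) = algebraMap k carrier (σ a)

namespace SigmaAlg

variable {k : Type u} [CommRing k] {σ : k →+* k}

instance : CoeSort (SigmaAlg k σ) (Type u) := ⟨carrier⟩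

instance (R : SigmaAlg k σ) : CommRing R := R.commRing

instance (R : SigmaAlg k σ) : Algebra k R := R.algebra

/-- A morphism of `k`-`σ`-algebras: a `k`-algebra morphism commuting with `σ`. -/
@[ext]
structure Hom (R S : SigmaAlg k σ) where
  toAlgHom : R →ₐ[k] S
  map_sig : ∀ a : R, toAlgHom (R.sig a) = S.sig (toAlgHom a)

/-- The category of `k`-`σ`-algebras. -/
instance : Category (SigmaAlg k σ) where
  Hom R S := Hom R S
  id R := ⟨AlgHom.id k R, fun _ => rfl⟩
  comp f g := ⟨g.toAlgHom.comp f.toAlgHom, fun a => by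
    simp [f.map_sig, g.map_sig]⟩

/-- The underlying `k`-algebra morphism of a morphism of `k`-`σ`-algebras. -/
def algHom {R S : SigmaAlg k σ} (f : R ⟶ S) : R →ₐ[k] S := Hom.toAlgHom f

@[simp]
theorem algHom_id (R : SigmaAlg k σ) : algHom (𝟙 R) = AlgHom.id k R := rfl

@[simp]
theorem algHom_comp {R S T : SigmaAlg k σ} (f : R ⟶ S) (g : S ⟶ T) :
    algHom (f ≫ g) = (algHom g).comp (algHom f) := rfl

/-- `A` is finitely `σ`-generated over `k`: there is a finite subset such that the only
`k`-`σ`-subalgebra (`k`-subalgebra stable under `σ`) containing it is `A` itself. -/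
def FinitelySigmaGenerated (A : SigmaAlg k σ) : Prop :=
  ∃ s : Finset A, ∀ B : Subalgebra k A,
    (s : Set A) ⊆ B → (∀ b ∈ B, A.sig b ∈ B) → B = ⊤

/-- An ideal stable under `σ`. -/
def IsSigmaIdeal (A : SigmaAlg k σ) (I : Ideal A) : Prop :=
  ∀ a ∈ I, A.sig a ∈ I

end SigmaAlg

section Geometry

variable {k : Type u} [CommRing k] {σ : k →+* k}

/-- A (affine) difference variety: a set-valued functor on `k`-`σ`-algebras that is
representable by a finitely `σ`-generated `k`-`σ`-algebra. -/
def IsSigmaVariety (X : SigmaAlg k σ ⥤ Type u) : Prop :=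
  ∃ A : SigmaAlg k σ, A.FinitelySigmaGenerated ∧ Nonempty (X.CorepresentableBy A)

/-- The family of subsets `Z R ⊆ X R` is a `σ`-closed `σ`-subvariety of the `σ`-variety `X`:
`X` has a coordinate ring `A`, so that `X R = Hom(A, R)`, and there is a `σ`-ideal `I` of `A`
such that `Z R` is the set of points `A ⟶ R` which vanish on `I`. -/
def IsSigmaClosed (X : SigmaAlg k σ ⥤ Type u) (Z : ∀ R : SigmaAlg k σ, Set (X.obj R)) : Prop :=
  ∃ (A : SigmaAlg k σ) (_ : A.FinitelySigmaGenerated) (e : X.CorepresentableBy A) (I : Ideal A),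
    A.IsSigmaIdeal I ∧
      ∀ (R : SigmaAlg k σ) (ψ : A ⟶ R),
        e.homEquiv ψ ∈ Z R ↔ ∀ f ∈ I, SigmaAlg.algHom ψ f = 0

/-- A morphism of `σ`-varieties is a `σ`-closed embedding if it induces an isomorphism of its
source with a `σ`-closed `σ`-subvariety of its target: it is injective on `R`-points for all `R`
and the images form a `σ`-closed `σ`-subvariety. -/
def IsSigmaClosedEmbedding {X Y : SigmaAlg k σ ⥤ Type u} (φ : X ⟶ Y) : Prop :=
  (∀ R : SigmaAlg k σ, Function.Injective (φ.app R)) ∧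
    IsSigmaClosed Y (fun R => Set.range (φ.app R))

/-- A `σ`-algebraic group: a group-valued functor on `k`-`σ`-algebras whose underlying set-valued
functor is a `σ`-variety. Morphisms are natural transformations of group-valued functors. -/
def IsSigmaAlgebraicGroup (G : SigmaAlg k σ ⥤ GrpCat.{u}) : Prop :=
  IsSigmaVariety (G ⋙ forget GrpCat.{u})

/-- A `σ`-closed subgroup of `G`: a `σ`-closed `σ`-subvariety `H` of `G` such that `H R` is a
subgroup of `G R` for all `R`. -/
structure SigmaClosedSubgroup (G : SigmaAlg k σ ⥤ GrpCat.{u}) where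
  points : ∀ R : SigmaAlg k σ, Subgroup (G.obj R)
  isSigmaClosed : IsSigmaClosed (G ⋙ forget GrpCat.{u}) (fun R => (points R : Set (G.obj R)))

end Geometry

section Representations

variable {k : Type u} [CommRing k] {σ : k →+* k}
variable (V : Type u) [AddCommGroup V] [Module k V]

/-- Base change of an `R`-linear endomorphism `g` of `R ⊗ V` along `f : R ⟶ S`: the `S`-linear
endomorphism of `S ⊗ V` with `s ⊗ v ↦ s • (f ⊗ V) (g (1 ⊗ v))`. -/
noncomputable def endBaseChangeFun {R S : SigmaAlg k σ} (f : R ⟶ S)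
    (g : Module.End R (R ⊗[k] V)) : Module.End S (S ⊗[k] V) :=
  LinearMap.liftBaseChange S
    ((SigmaAlg.algHom f).toLinearMap.rTensor V ∘ₗ g.restrictScalars k ∘ₗ TensorProduct.mk k R V 1)

theorem rTensor_smul {R S : SigmaAlg k σ} (f : R ⟶ S) (r : R) (x : R ⊗[k] V) :
    (SigmaAlg.algHom f).toLinearMap.rTensor V (r • x) =
      SigmaAlg.algHom f r • (SigmaAlg.algHom f).toLinearMap.rTensor V x := by
  induction x with
  | zero => simp
  | tmul a v => simp [TensorProduct.smul_tmul']
  | add x y hx hy => simp [smul_add, hx, hy]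

/-- The base change is the endomorphism compatible with `f ⊗ V`. -/
theorem endBaseChangeFun_rTensor {R S : SigmaAlg k σ} (f : R ⟶ S)
    (g : Module.End R (R ⊗[k] V)) (x : R ⊗[k] V) :
    endBaseChangeFun V f g ((SigmaAlg.algHom f).toLinearMap.rTensor V x) =
      (SigmaAlg.algHom f).toLinearMap.rTensor V (g x) := by
  induction x with
  | zero => simp
  | tmul a v =>
    have h : a ⊗ₜ[k] v = a • ((1 : R) ⊗ₜ[k] v) := by simp [TensorProduct.smul_tmul']
    rw [h, map_smul g, rTensor_smul, rTensor_smul, map_smul (endBaseChangeFun V f g)]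
    simp [endBaseChangeFun]
  | add x y hx hy => simp [hx, hy]

theorem end_ext_one {S : SigmaAlg k σ} {g h : Module.End S (S ⊗[k] V)}
    (H : ∀ v : V, g (1 ⊗ₜ v) = h (1 ⊗ₜ v)) : g = h := by
  refine TensorProduct.AlgebraTensorModule.curry_injective ?_
  refine LinearMap.ext_ring (LinearMap.ext fun v => ?_)
  exact H v

/-- Base change of endomorphisms as a multiplicative map. -/
noncomputable def endBaseChange {R S : SigmaAlg k σ} (f : R ⟶ S) :
    Module.End R (R ⊗[k] V) →* Module.End S (S ⊗[k] V) where
  toFun := endBaseChangeFun V f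
  map_one' := end_ext_one V fun v => by simp [endBaseChangeFun]
  map_mul' g h := end_ext_one V fun v => by
    have e : (1 : S) ⊗ₜ[k] v = (SigmaAlg.algHom f).toLinearMap.rTensor V ((1 : R) ⊗ₜ[k] v) := by
      simp
    rw [e, Module.End.mul_apply, endBaseChangeFun_rTensor, endBaseChangeFun_rTensor,
      endBaseChangeFun_rTensor, Module.End.mul_apply]

/-- The group-valued functor `GL(V)`: it sends `R` to the group of `R`-linear automorphisms of
`R ⊗ V`, and a morphism to base change along it. -/
noncomputable def sigmaGL : SigmaAlg k σ ⥤ GrpCat.{u} where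
  obj R := GrpCat.of (LinearMap.GeneralLinearGroup R (R ⊗[k] V))
  map f := GrpCat.ofHom (Units.map (endBaseChange V f))
  map_id R := by
    refine GrpCat.hom_ext (MonoidHom.ext fun g => ?_)
    refine Units.ext (end_ext_one V fun v => ?_)
    simp [endBaseChange, endBaseChangeFun]
  map_comp {R S T} f g := by
    refine GrpCat.hom_ext (MonoidHom.ext fun x => ?_)
    refine Units.ext (end_ext_one V fun v => ?_)
    have e : (1 : S) ⊗ₜ[k] v = (SigmaAlg.algHom f).toLinearMap.rTensor V ((1 : R) ⊗ₜ[k] v) := by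
      simp
    have e' : (1 : T) ⊗ₜ[k] v = (SigmaAlg.algHom g).toLinearMap.rTensor V ((1 : S) ⊗ₜ[k] v) := by
      simp
    change endBaseChangeFun V (f ≫ g) x.val _ =
      endBaseChangeFun V g (endBaseChangeFun V f x.val) _
    rw [e', endBaseChangeFun_rTensor, e, endBaseChangeFun_rTensor, ← LinearMap.comp_apply,
      ← LinearMap.comp_apply, ← LinearMap.rTensor_comp]
    exact endBaseChangeFun_rTensor V (f ≫ g) x.val _

variable {V}

/-- A representation `φ : G ⟶ GL(V)` is faithful if it is a `σ`-closed embedding. -/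
def IsFaithfulRep {G : SigmaAlg k σ ⥤ GrpCat.{u}} (φ : G ⟶ sigmaGL V) : Prop :=
  IsSigmaClosedEmbedding (Functor.whiskerRight φ (forget GrpCat.{u}))

/-- The `R`-linear automorphism of `R ⊗ V` by which `g ∈ G R` acts in the representation `φ`. -/
noncomputable def repAction {G : SigmaAlg k σ ⥤ GrpCat.{u}} (φ : G ⟶ sigmaGL V)
    (R : SigmaAlg k σ) (g : G.obj R) : LinearMap.GeneralLinearGroup R (R ⊗[k] V) :=
  (φ.app R).hom g

/-- The `R`-points of the stabilizer of a subspace `W` of `V`: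
all `g ∈ G R` with `g (R ⊗ W) ⊆ R ⊗ W`. -/
def stabilizerPoints {G : SigmaAlg k σ ⥤ GrpCat.{u}} (φ : G ⟶ sigmaGL V) (W : Submodule k V)
    (R : SigmaAlg k σ) : Set (G.obj R) :=
  {g | ∀ x ∈ W.baseChange R, (repAction φ R g).val x ∈ W.baseChange R}

end Representations

/-!
The coordinate ring `A` of `G` is a Hopf algebra over `k` on which `σ` acts by a semilinear
endomorphism compatible with the Hopf structure, and `H` is cut out by a Hopf ideal `I` of `A` that
is stable under `σ`. As in the classical theorem of Chevalley, `H` should be the subgroup preserving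
`W = V ∩ I` for a suitable finite-dimensional subcomodule `V` of `A`, and passing to an exterior
power replaces `W` by a line. For this `V` has to contain finitely many elements which generate `I`
as a `σ`-stable ideal.

Such elements exist although `σ`-stable ideals in general are not finitely generated
(`exists_finset_generating_hopfIdeal`). Filter `A` by the Hopf subalgebras `A_i` generated by the
transforms of order at most `i` of the coordinates. The kernels of the projections of `H` from order
`i + 1` to order `i` are closed subschemes of one fixed affine space. Their ideals `J_i` satisfy
`σ(J_i) ⊆ J_{i+1}`, and by comparing leading exponents `J_{i+1}` is generated by `σ(J_i)` for
large `i` (`exists_forall_ge_eq_map_of_twisted_chain`). So for large `m` the `σ`-ideal `I'` generated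
by `I ∩ A_m` contains `I ∩ A_{i+1}` up to functions in `A_i` vanishing at the identity, for all
`i ≥ m`. Geometrically, a point `g` of the scheme defined by `I'` and a point `h` of `H` with the
same restriction to `A_i` differ by an element of the kernel of the projection to order `i`, so that
`g` satisfies the equations in `I ∩ A_{i+1}`. To conclude that these equations lie in `I'`, points
`h` must exist after an extension of rings under which elements do not become zero, and this is
the fact that the inclusion of a Hopf subalgebra in a Hopf algebra is pure
(`IsHopfSubalgebra.exists_retraction`). It is proved without flatness theory: the Fitting
ideals describing linear equations over the subalgebra are stable under translation, hence trivial,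
and then Cramer's rule solves the equations
(`IsHopfSubalgebra.le_of_le_sup_augmentation` carries out the comparison).

With `V` containing such generators and `σ`-generators of `A`, choose a basis of `V` adapted to
`W`. The coaction gives a block matrix `ρ` over `A` whose entries `σ`-generate `A` and whose lower
left block lies in `I` and generates it (`exists_multiplicative_matrix_adapted_ideal`). The
representation is the direct sum of the one given by `ρ` and its tensor power with `dim W` factors,
which contains the exterior power. The line is spanned by the exterior product of the first basis
vectors, and it is stable exactly if the lower left block vanishes
(`exists_kronPow_mulVec_wedgeVec_iff`). The representation is faithful because the entries of `ρ`
`σ`-generate `A` (`isFaithfulRep_repOfMatrix`).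
-/

/-! ### Slices of tensors -/

section Slices

variable {k M N : Type*} [Field k] [AddCommGroup M] [Module k M] [AddCommGroup N] [Module k N]

/-- The slice `M ⊗ N → M` along a functional `l` on `N`: the map `m ⊗ n ↦ l n • m`. -/
noncomputable def tensorSlice (M : Type*) [AddCommGroup M] [Module k M] (l : N →ₗ[k] k) :
    M ⊗[k] N →ₗ[k] M :=
  (TensorProduct.rid k M).toLinearMap ∘ₗ l.lTensor M

@[simp]
theorem tensorSlice_tmul (l : N →ₗ[k] k) (m : M) (n : N) :
    tensorSlice M l (m ⊗ₜ[k] n) = l n • m := by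
  simp [tensorSlice]

/-- Finitely many tensors are simultaneously recovered from finitely many of their slices. -/
theorem exists_eq_sum_tensorSlice_tmul {κ : Type*} [Finite κ] (x : κ → M ⊗[k] N) :
    ∃ (n : ℕ) (l : Fin n → N →ₗ[k] k) (b : Fin n → N),
      ∀ i, x i = ∑ j, tensorSlice M (l j) (x i) ⊗ₜ[k] b j := by
  classical
  cases nonempty_fintype κ
  let C := Module.Basis.ofVectorSpace k N
  let F : Finset (Module.Basis.ofVectorSpaceIndex k N) :=
    Finset.univ.biUnion fun i => (TensorProduct.equivFinsuppOfBasisRight C (x i)).support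
  refine ⟨F.card, fun j => C.coord (F.equivFin.symm j), fun j => C (F.equivFin.symm j), fun i => ?_⟩
  rw [F.equivFin.symm.sum_comp
    (fun j : F => tensorSlice M (C.coord (j : _)) (x i) ⊗ₜ[k] C (j : _)),
    Finset.sum_coe_sort F (fun j => tensorSlice M (C.coord j) (x i) ⊗ₜ[k] C j)]
  conv_lhs => rw [← (TensorProduct.equivFinsuppOfBasisRight C).symm_apply_apply (x i)]
  rw [TensorProduct.equivFinsuppOfBasisRight_symm_apply,
    Finsupp.sum_of_support_subset _ (s := F) _ _ (by simp)]
  · refine Finset.sum_congr rfl fun j _ => ?_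
    rw [TensorProduct.equivFinsuppOfBasisRight_apply]
    rfl
  · exact Finset.subset_biUnion_of_mem
      (fun i => (TensorProduct.equivFinsuppOfBasisRight C (x i)).support) (Finset.mem_univ i)

theorem exists_eq_sum_tensorSlice_tmul_single (x : M ⊗[k] N) :
    ∃ (n : ℕ) (l : Fin n → N →ₗ[k] k) (b : Fin n → N),
      x = ∑ j, tensorSlice M (l j) x ⊗ₜ[k] b j := by
  obtain ⟨n, l, b, h⟩ := exists_eq_sum_tensorSlice_tmul (fun _ : Unit => x)
  exact ⟨n, l, b, h ()⟩

theorem tensorSlice_map {M' : Type*} [AddCommGroup M'] [Module k M']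
    {N' : Type*} [AddCommGroup N'] [Module k N']
    (f : M →ₗ[k] M') (g : N →ₗ[k] N') (l : N' →ₗ[k] k) (x : M ⊗[k] N) :
    tensorSlice M' l (TensorProduct.map f g x) = f (tensorSlice M (l ∘ₗ g) x) := by
  induction x with
  | zero => simp
  | tmul a b => simp
  | add a b ha hb => simp [ha, hb]

theorem tensorSlice_mul {B C : Type*} [CommRing B] [Algebra k B] [CommRing C] [Algebra k C]
    (l : C →ₗ[k] k) (u : B) (w : C) (x : B ⊗[k] C) :
    tensorSlice B l ((u ⊗ₜ[k] w) * x) = u * tensorSlice B (l ∘ₗ LinearMap.mulLeft k w) x := by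
  induction x with
  | zero => simp
  | tmul a b => simp
  | add a b ha hb => simp [ha, hb, mul_add]

end Slices

/-! ### Hopf subalgebras -/

section Hopf

variable {k B : Type*} [Field k] [CommRing B] [HopfAlgebra k B]

open Coalgebra HopfAlgebra

/-- A subalgebra of a Hopf algebra stable under comultiplication and antipode. -/
structure IsHopfSubalgebra (S : Subalgebra k B) : Prop where
  comul_mem : ∀ b ∈ S, comul (R := k) b ∈ (Algebra.TensorProduct.map S.val S.val).range
  antipode_mem : ∀ b ∈ S, antipode k b ∈ S

theorem IsHopfSubalgebra.tensorSlice_comul_mem {S : Subalgebra k B} (hS : IsHopfSubalgebra S)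
    {b : B} (hb : b ∈ S) (l : B →ₗ[k] k) : tensorSlice B l (comul (R := k) b) ∈ S := by
  obtain ⟨z, hz⟩ := hS.comul_mem b hb
  rw [← hz]
  exact (congrArg (· ∈ S) (tensorSlice_map S.val.toLinearMap S.val.toLinearMap l z)).mpr
    (SetLike.coe_mem _)

theorem counit_tensorSlice_comul (l : B →ₗ[k] k) (b : B) :
    counit (R := k) (tensorSlice B l (comul (R := k) b)) = l b := by
  have h : ∀ x : B ⊗[k] B, counit (R := k) (tensorSlice B l x) =
      l (TensorProduct.lid k B ((counit (R := k)).rTensor B x)) := by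
    intro x
    induction x with
    | zero => simp
    | tmul a b => simp [mul_comm]
    | add a b ha hb => simp [ha, hb]
  rw [h, rTensor_counit_comul]
  simp

theorem tensorSlice_counit_comul (b : B) :
    tensorSlice B (counit (R := k)) (comul (R := k) b) = b := by
  rw [tensorSlice, LinearMap.comp_apply, lTensor_counit_comul]
  simp

/-- A nonzero translation-stable ideal `J` of a Hopf subalgebra `S` contains `1`: translation
carries a nonvanishing value to the identity element, and `1` is recovered from an `x ∈ J` with
`ε x = 1` as the product of `x₁ ∈ J` and `S x₂`. -/
theorem IsHopfSubalgebra.one_mem_of_stable {S : Subalgebra k B} (hS : IsHopfSubalgebra S)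
    (J : Submodule S B) (hJS : ∀ x ∈ J, x ∈ S)
    (hst : ∀ x ∈ J, ∀ l : B →ₗ[k] k, tensorSlice B l (comul (R := k) x) ∈ J)
    {y : B} (hy : y ∈ J) (hy0 : y ≠ 0) : (1 : B) ∈ J := by
  obtain ⟨l, hl⟩ : ∃ l : B →ₗ[k] k, l y ≠ 0 := by
    by_contra! h
    exact hy0 ((Module.forall_dual_apply_eq_zero_iff k y).1 h)
  set x := tensorSlice B l (comul (R := k) y) with hx
  have hxJ : x ∈ J := hst y hy l
  have hεx : counit (R := k) x ≠ 0 := by rwa [hx, counit_tensorSlice_comul]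
  obtain ⟨z, hz⟩ := hS.comul_mem x (hJS x hxJ)
  obtain ⟨n, m, b, hzb⟩ := exists_eq_sum_tensorSlice_tmul_single z
  have hmem : ∀ j, ((tensorSlice S (m j) z : S) : B) ∈ J := by
    intro j
    obtain ⟨l', hl'⟩ := LinearMap.exists_extend (p := Subalgebra.toSubmodule S) (m j)
    have := hst x hxJ l'
    rw [← hz] at this
    have e := tensorSlice_map S.val.toLinearMap S.val.toLinearMap l' z
    have e2 : l' ∘ₗ S.val.toLinearMap = m j := hl'
    rw [e2] at e
    exact (congrArg (· ∈ J) e).mp this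
  have key := mul_antipode_lTensor_comul_apply (R := k) x
  rw [← hz, hzb] at key
  simp only [map_sum] at key
  have hsum : algebraMap k B (counit (R := k) x) ∈ J := by
    rw [← key]
    refine Submodule.sum_mem _ fun j _ => ?_
    have : (LinearMap.mul' k B) ((LinearMap.lTensor B (antipode k))
        ((Algebra.TensorProduct.map S.val S.val).toRingHom
          (tensorSlice S (m j) z ⊗ₜ[k] b j))) =
        (⟨antipode k (b j : B), hS.antipode_mem _ (b j).2⟩ : S) •
          ((tensorSlice S (m j) z : S) : B) := by
      simp [Subalgebra.smul_def, mul_comm]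
    exact this ▸ J.smul_mem _ (hmem j)
  have := J.smul_mem (algebraMap k S (counit (R := k) x)⁻¹) hsum
  rwa [Subalgebra.smul_def, smul_eq_mul, Subalgebra.coe_algebraMap, ← map_mul,
    inv_mul_cancel₀ hεx, map_one] at this

end Hopf

/-! ### Finite-dimensional subcomodules and their matrix coefficients -/

section Comodule

variable {k B : Type*} [Field k] [CommRing B] [HopfAlgebra k B]

open Coalgebra HopfAlgebra

theorem LinearIndependent.exists_dual {M ι : Type*} [AddCommGroup M] [Module k M] [DecidableEq ι]
    {v : ι → M} (hv : LinearIndependent k v) (i : ι) :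
    ∃ f : M →ₗ[k] k, ∀ j, f (v j) = if j = i then 1 else 0 := by
  obtain ⟨f, hf⟩ := LinearMap.exists_extend ((Module.Basis.span hv).coord i)
  refine ⟨f, fun j => ?_⟩
  have h := LinearMap.congr_fun hf (Module.Basis.span hv j)
  rw [Module.Basis.coord_apply, Module.Basis.repr_self, Finsupp.single_apply] at h
  rw [← h, LinearMap.comp_apply, Submodule.subtype_apply, Module.Basis.span_apply]

theorem LinearIndependent.tmul_sum_injective {M N ι : Type*} [AddCommGroup M] [Module k M]
    [AddCommGroup N] [Module k N] [Fintype ι] {v : ι → M} (hv : LinearIndependent k v)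
    {x y : ι → N} (h : ∑ i, v i ⊗ₜ[k] x i = ∑ i, v i ⊗ₜ[k] y i) : x = y := by
  classical
  funext i
  obtain ⟨f, hf⟩ := hv.exists_dual i
  have := congrArg (fun z => TensorProduct.lid k N (f.rTensor N z)) h
  simpa [hf, ite_smul] using this

/-- A slice of the comultiplication of a slice is a slice along the convolution of the functionals;
hence the slices of one element span a subcomodule. -/
theorem tensorSlice_comul_tensorSlice_comul (l l' : B →ₗ[k] k) (b : B) :
    tensorSlice B l' (comul (R := k) (tensorSlice B l (comul (R := k) b))) =
      tensorSlice B (LinearMap.mul' k k ∘ₗ TensorProduct.map l' l ∘ₗ comul) (comul (R := k) b) := by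
  have h1 : ∀ (y : B ⊗[k] B) (c : B),
      tensorSlice B (LinearMap.mul' k k ∘ₗ TensorProduct.map l' l)
        (TensorProduct.assoc k B B B (y ⊗ₜ c)) = l c • tensorSlice B l' y := by
    intro y c
    induction y with
    | zero => simp
    | tmul a b => simp [smul_smul, mul_comm]
    | add a b ha hb => simp [add_tmul, ha, hb]
  have h2 : ∀ x : B ⊗[k] B, tensorSlice B l' (comul (R := k) (tensorSlice B l x)) =
      tensorSlice B (LinearMap.mul' k k ∘ₗ TensorProduct.map l' l)
        (TensorProduct.assoc k B B B (comul.rTensor B x)) := by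
    intro x
    induction x with
    | zero => simp
    | tmul a b => simp [h1]
    | add a b ha hb => simp [ha, hb]
  rw [h2, coassoc_apply]
  have := tensorSlice_map (LinearMap.id : B →ₗ[k] B) (comul (R := k) (A := B))
    (LinearMap.mul' k k ∘ₗ TensorProduct.map l' l) (comul (R := k) b)
  exact this

/-- Every finite subset of a Hopf algebra lies in a finite-dimensional subcomodule. -/
theorem exists_finiteDimensional_subcomodule (F : Finset B) :
    ∃ V : Submodule k B, FiniteDimensional k V ∧ (F : Set B) ⊆ V ∧
      ∀ v ∈ V, ∀ l : B →ₗ[k] k, tensorSlice B l (comul (R := k) v) ∈ V := by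
  classical
  let V : Submodule k B := Submodule.span k
    {x | ∃ f ∈ F, ∃ l : B →ₗ[k] k, x = tensorSlice B l (comul (R := k) f)}
  refine ⟨V, ?_, fun f hf => ?_, fun v hv l => ?_⟩
  · choose n l b h using fun f : B => exists_eq_sum_tensorSlice_tmul_single (comul (R := k) f)
    let T : Finset B := F.biUnion fun f =>
      Finset.univ.image fun j => tensorSlice B (l f j) (comul (R := k) f)
    have hle : V ≤ Submodule.span k (T : Set B) := by
      refine Submodule.span_le.2 ?_
      rintro x ⟨f, hf, m, rfl⟩
      rw [h f, map_sum]
      refine Submodule.sum_mem _ fun j _ => ?_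
      rw [tensorSlice_tmul]
      refine Submodule.smul_mem _ _ (Submodule.subset_span ?_)
      exact Finset.mem_biUnion.2 ⟨f, hf, Finset.mem_image_of_mem _ (Finset.mem_univ j)⟩
    have : FiniteDimensional k (Submodule.span k (T : Set B)) :=
      FiniteDimensional.span_finset k T
    exact Submodule.finiteDimensional_of_le hle
  · exact Submodule.subset_span ⟨f, hf, counit, (tensorSlice_counit_comul f).symm⟩
  · induction hv using Submodule.span_induction with
    | mem x hx =>
      obtain ⟨f, hf, m, rfl⟩ := hx
      rw [tensorSlice_comul_tensorSlice_comul]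
      exact Submodule.subset_span ⟨f, hf, _, rfl⟩
    | zero => simp
    | add x y _ _ hx hy => simpa using add_mem hx hy
    | smul a x _ hx => simpa using Submodule.smul_mem _ a hx

/-- `ρ` is the matrix of the coaction on the family `v`: `Δ v_j = ∑ v_l ⊗ ρ_lj`. -/
def IsCoactionMatrix {ι : Type*} [Fintype ι] (v : ι → B) (ρ : Matrix ι ι B) : Prop :=
  ∀ j, comul (R := k) (v j) = ∑ l, v l ⊗ₜ[k] ρ l j

theorem exists_isCoactionMatrix {ι : Type*} [Fintype ι] (v : ι → B)
    (h : ∀ j, ∀ l : B →ₗ[k] k,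
      tensorSlice B l (comul (R := k) (v j)) ∈ Submodule.span k (Set.range v)) :
    ∃ ρ : Matrix ι ι B, IsCoactionMatrix (k := k) v ρ := by
  have : ∀ j, ∃ r : ι → B, comul (R := k) (v j) = ∑ l, v l ⊗ₜ[k] r l := by
    intro j
    obtain ⟨n, l, b, hx⟩ := exists_eq_sum_tensorSlice_tmul_single (comul (R := k) (v j))
    choose c hc using fun t => (Submodule.mem_span_range_iff_exists_fun k).1 (h j (l t))
    refine ⟨fun i => ∑ t, c t i • b t, ?_⟩
    rw [hx]
    simp_rw [← hc, sum_tmul, tmul_sum, smul_tmul]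
    exact Finset.sum_comm
  choose r hr using this
  exact ⟨fun l j => r j l, hr⟩

namespace IsCoactionMatrix

variable {ι : Type*} [Fintype ι] {v : ι → B} {ρ : Matrix ι ι B}

theorem comul_apply (h : IsCoactionMatrix (k := k) v ρ) (hv : LinearIndependent k v) (i j : ι) :
    comul (R := k) (ρ i j) = ∑ m, ρ i m ⊗ₜ[k] ρ m j := by
  have e := coassoc_apply (R := k) (v j)
  rw [h j] at e
  simp only [map_sum, LinearMap.rTensor_tmul, LinearMap.lTensor_tmul, h _, sum_tmul,
    TensorProduct.assoc_tmul] at e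
  rw [Finset.sum_comm] at e
  simp_rw [← tmul_sum] at e
  exact (congrFun (hv.tmul_sum_injective e) i).symm

theorem counit_apply [DecidableEq ι] (h : IsCoactionMatrix (k := k) v ρ)
    (hv : LinearIndependent k v) (i j : ι) :
    counit (R := k) (ρ i j) = if i = j then 1 else 0 := by
  have e := lTensor_counit_comul (R := k) (v j)
  rw [h j] at e
  simp only [map_sum, LinearMap.lTensor_tmul] at e
  have e2 : v j ⊗ₜ[k] (1 : k) = ∑ l, v l ⊗ₜ[k] (if l = j then (1 : k) else 0) := by
    simp [tmul_ite]
  exact congrFun (hv.tmul_sum_injective (e.trans e2)) i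

theorem eq_sum_counit_smul (h : IsCoactionMatrix (k := k) v ρ) (j : ι) :
    v j = ∑ l, counit (R := k) (v l) • ρ l j := by
  have e := rTensor_counit_comul (R := k) (v j)
  rw [h j] at e
  have := congrArg (TensorProduct.lid k B) e
  simpa using this.symm

theorem map_antipode_mul [DecidableEq ι] (h : IsCoactionMatrix (k := k) v ρ)
    (hv : LinearIndependent k v) : ρ.map (antipode k) * ρ = 1 := by
  ext i j
  have e := mul_antipode_rTensor_comul_apply (R := k) (ρ i j)
  rw [h.comul_apply hv, h.counit_apply hv] at e
  simpa [Matrix.mul_apply, Matrix.one_apply, apply_ite (algebraMap k B)] using e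

theorem comul_eq_mul [DecidableEq ι] (h : IsCoactionMatrix (k := k) v ρ)
    (hv : LinearIndependent k v) :
    ρ.map (Bialgebra.comulAlgHom k B) =
      ρ.map (Algebra.TensorProduct.includeLeft : B →ₐ[k] B ⊗[k] B) *
        ρ.map (Algebra.TensorProduct.includeRight : B →ₐ[k] B ⊗[k] B) := by
  ext i j
  simp [Matrix.mul_apply, h.comul_apply hv]

theorem antipode_antipode (h : IsCoactionMatrix (k := k) v ρ)
    (hv : LinearIndependent k v) (i j : ι) : antipode k (antipode k (ρ i j)) = ρ i j := by
  classical
  have h1 := h.map_antipode_mul hv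
  have h2 : (ρ.map (antipode k)).map (antipodeAlgHom k B) * ρ.map (antipode k) = 1 := by
    have := congrArg (fun M : Matrix ι ι B => M.map (antipodeAlgHom k B)) h1
    simp only [Matrix.map_mul] at this
    rw [Matrix.map_one _ (map_zero _) (map_one _)] at this
    exact this
  have h3 : (ρ.map (antipode k)).map (antipodeAlgHom k B) = ρ := left_inv_eq_right_inv h2 h1
  exact congrFun (congrFun h3 i) j

theorem _root_.Matrix.eq_mul_of_left_inverses {ι T : Type*} [Fintype ι] [DecidableEq ι]
    [CommRing T]
    {D D' L L' R R' : Matrix ι ι T} (hD : D = L * R) (hD' : D' * D = 1) (hL : L' * L = 1)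
    (hR : R' * R = 1) : D' = R' * L' := by
  refine left_inv_eq_right_inv hD' ?_
  have hR' := mul_eq_one_comm.1 hR
  have hL' := mul_eq_one_comm.1 hL
  rw [hD, mul_assoc, ← mul_assoc R, hR', one_mul, hL']

theorem comul_antipode_apply (h : IsCoactionMatrix (k := k) v ρ)
    (hv : LinearIndependent k v) (i j : ι) :
    comul (R := k) (antipode k (ρ i j)) =
      ∑ m, antipode k (ρ m j) ⊗ₜ[k] antipode k (ρ i m) := by
  classical
  have h1 := h.map_antipode_mul hv
  have key : ∀ f : B →ₐ[k] B ⊗[k] B, (ρ.map (antipode k)).map f * ρ.map f = 1 := by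
    intro f
    rw [← Matrix.map_mul, h1, Matrix.map_one _ (map_zero _) (map_one _)]
  have h3 := Matrix.eq_mul_of_left_inverses (h.comul_eq_mul hv) (key _) (key _) (key _)
  have h4 := congrFun (congrFun h3 i) j
  rw [Matrix.mul_apply] at h4
  refine h4.trans (Finset.sum_congr rfl fun m _ => ?_)
  simp

end IsCoactionMatrix

end Comodule

/-! ### The retraction onto a Hopf subalgebra -/

section Retraction

variable {k B : Type*} [Field k] [CommRing B] [HopfAlgebra k B]

open Coalgebra HopfAlgebra

variable {ι : Type*} [Fintype ι]

/-- A relation of `v` modulo `S`: a tuple `c` with entries in `S` such that `∑ c_i v_i ∈ S`. -/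
structure IsRelationMod (S : Subalgebra k B) (v c : ι → B) : Prop where
  mem : ∀ i, c i ∈ S
  sum_mem : ∑ i, c i * v i ∈ S

/-- The `S`-module generated by the `s × s`-minors of matrices whose rows are relations of `v`
modulo `S`. It is a Fitting ideal of the `S`-module generated by `v` modulo `S`. -/
def relationMinors (S : Subalgebra k B) (v : ι → B) (s : ℕ) : Submodule S B :=
  Submodule.span S {D | ∃ (c : Fin s → ι → B) (_ : ∀ p, IsRelationMod S v (c p)) (J : Fin s → ι),
    D = (Matrix.of fun p q => c p (J q)).det}

theorem det_mem_subalgebra {n : Type*} [Fintype n] [DecidableEq n] (S : Subalgebra k B)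
    (M : Matrix n n B) (h : ∀ i j, M i j ∈ S) : M.det ∈ S := by
  rw [Matrix.det_apply]
  exact S.sum_mem fun τ _ => by
    rw [Units.smul_def]
    exact S.zsmul_mem (S.prod_mem fun i _ => h _ _) _

theorem relationMinors_le (S : Subalgebra k B) (v : ι → B) (s : ℕ) :
    ∀ x ∈ relationMinors S v s, x ∈ S := by
  intro x hx
  induction hx using Submodule.span_induction with
  | mem x hx =>
    obtain ⟨c, hc, J, rfl⟩ := hx
    exact det_mem_subalgebra S _ fun p q => (hc p).mem _
  | zero => exact S.zero_mem
  | add x y _ _ hx hy => exact S.add_mem hx hy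
  | smul a x _ hx => exact S.mul_mem a.2 hx

/-- The translate `X_l = ∑_j Δ(c_j) (1 ⊗ ρ_lj)` of a relation `c`. -/
noncomputable def relationTranslate (ρ : Matrix ι ι B) (c : ι → B) (l : ι) : B ⊗[k] B :=
  ∑ j, ((1 : B) ⊗ₜ[k] ρ l j) * comul (R := k) (c j)

/-- Slices of the translate of a relation are relations. -/
theorem IsRelationMod.translate {S : Subalgebra k B} (hS : IsHopfSubalgebra S) {v c : ι → B}
    {ρ : Matrix ι ι B} (h : IsCoactionMatrix (k := k) v ρ) (hc : IsRelationMod S v c)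
    (m : B →ₗ[k] k) :
    IsRelationMod S v fun l => tensorSlice B m (relationTranslate (k := k) ρ c l) where
  mem l := by
    rw [relationTranslate, map_sum]
    refine S.sum_mem fun j _ => ?_
    rw [tensorSlice_mul, one_mul]
    exact hS.tensorSlice_comul_mem (hc.mem j) _
  sum_mem := by
    have e : ∑ l, tensorSlice B m (relationTranslate (k := k) ρ c l) * v l =
        tensorSlice B m (comul (R := k) (∑ j, c j * v j)) := by
      have h1 : ∀ l, tensorSlice B m (relationTranslate (k := k) ρ c l) * v l =
          tensorSlice B m ((v l ⊗ₜ[k] (1 : B)) * relationTranslate (k := k) ρ c l) := by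
        intro l
        have : m ∘ₗ LinearMap.mulLeft k (1 : B) = m := by ext; simp
        rw [tensorSlice_mul, this, mul_comm]
      simp_rw [h1, ← map_sum]
      congr 1
      simp only [relationTranslate, Finset.mul_sum, map_sum, Bialgebra.comul_mul, h _]
      rw [Finset.sum_comm]
      refine Finset.sum_congr rfl fun j _ => Finset.sum_congr rfl fun l _ => ?_
      rw [← mul_assoc, Algebra.TensorProduct.tmul_mul_tmul, mul_one, one_mul, mul_comm]
    rw [e]
    exact hS.tensorSlice_comul_mem hc.sum_mem m

theorem comul_eq_sum_relationTranslate [DecidableEq ι] {v : ι → B} {ρ : Matrix ι ι B}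
    (h : IsCoactionMatrix (k := k) v ρ) (hv : LinearIndependent k v) (c : ι → B) (j : ι) :
    comul (R := k) (c j) =
      ∑ l, ((1 : B) ⊗ₜ[k] antipode k (ρ j l)) * relationTranslate (k := k) ρ c l := by
  have h1 := h.map_antipode_mul hv
  simp only [relationTranslate, Finset.mul_sum]
  rw [Finset.sum_comm]
  have h2 : ∀ i, ∑ l, ((1 : B) ⊗ₜ[k] antipode k (ρ j l)) *
      (((1 : B) ⊗ₜ[k] ρ l i) * comul (R := k) (c i)) =
      if j = i then comul (R := k) (c i) else 0 := by
    intro i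
    have h3 := congrFun (congrFun h1 j) i
    rw [Matrix.mul_apply] at h3
    simp only [Matrix.map_apply] at h3
    simp_rw [← mul_assoc, Algebra.TensorProduct.tmul_mul_tmul, ← Finset.sum_mul, one_mul,
      ← tmul_sum, h3, Matrix.one_apply]
    split_ifs
    · rw [← Algebra.TensorProduct.one_def, one_mul]
    · rw [tmul_zero, zero_mul]
  simp_rw [h2]
  simp

theorem tensorSlice_det_relationTranslate_mem {S : Subalgebra k B} (hS : IsHopfSubalgebra S)
    {v : ι → B} {ρ : Matrix ι ι B} (h : IsCoactionMatrix (k := k) v ρ) {s : ℕ}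
    (c : Fin s → ι → B) (hc : ∀ p, IsRelationMod S v (c p)) (J : Fin s → ι) (m : B →ₗ[k] k) :
    tensorSlice B m
      (Matrix.of fun p q => relationTranslate (k := k) ρ (c p) (J q)).det ∈
        relationMinors S v s := by
  classical
  obtain ⟨n, l, b, hx⟩ := exists_eq_sum_tensorSlice_tmul
    (fun i : Fin s × ι => relationTranslate (k := k) ρ (c i.1) i.2)
  have e : (Matrix.of fun p q => relationTranslate (k := k) ρ (c p) (J q)) =
      fun p => ∑ t, ((1 : B) ⊗ₜ[k] b t) •
        fun q => tensorSlice B (l t) (relationTranslate (k := k) ρ (c p) (J q)) ⊗ₜ[k] (1 : B) := by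
    ext p q
    rw [Matrix.of_apply, hx (p, J q), Finset.sum_apply]
    exact Finset.sum_congr rfl fun t _ => by
      simp [Algebra.TensorProduct.tmul_mul_tmul]
  rw [e]
  change tensorSlice B m (Matrix.detRowAlternating.toMultilinearMap _) ∈ _
  rw [MultilinearMap.map_sum, map_sum]
  refine Submodule.sum_mem _ fun r _ => ?_
  rw [MultilinearMap.map_smul_univ]
  have e2 : (∏ p, (1 : B) ⊗ₜ[k] b (r p)) = (1 : B) ⊗ₜ[k] ∏ p, b (r p) :=
    (map_prod (Algebra.TensorProduct.includeRight : B →ₐ[k] B ⊗[k] B) _ _).symm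
  have e3 : (Matrix.detRowAlternating.toMultilinearMap fun p q =>
      tensorSlice B (l (r p)) (relationTranslate (k := k) ρ (c p) (J q)) ⊗ₜ[k] (1 : B)) =
      (Matrix.of fun p q =>
        tensorSlice B (l (r p)) (relationTranslate (k := k) ρ (c p) (J q))).det ⊗ₜ[k] (1 : B) :=
    ((Algebra.TensorProduct.includeLeft : B →ₐ[k] B ⊗[k] B).map_det _).symm
  rw [e2, e3, smul_eq_mul, Algebra.TensorProduct.tmul_mul_tmul, one_mul, mul_one, tensorSlice_tmul]
  refine Submodule.smul_of_tower_mem _ _ (Submodule.subset_span ?_)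
  exact ⟨_, fun p => (hc p).translate hS h (l (r p)), J, rfl⟩

/-- The Fitting ideals of relations are stable under translation. -/
theorem tensorSlice_comul_relationMinors_mem {S : Subalgebra k B} (hS : IsHopfSubalgebra S)
    {v : ι → B} {ρ : Matrix ι ι B} (h : IsCoactionMatrix (k := k) v ρ)
    (hv : LinearIndependent k v) (s : ℕ) :
    ∀ x ∈ relationMinors S v s, ∀ m : B →ₗ[k] k,
      tensorSlice B m (comul (R := k) x) ∈ relationMinors S v s := by
  classical
  intro x hx
  induction hx using Submodule.span_induction with
  | mem x hx =>
    intro m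
    obtain ⟨c, hc, J, rfl⟩ := hx
    have e : comul (R := k) (Matrix.of fun p q => c p (J q)).det =
        (Matrix.of fun q p => comul (R := k) (c p (J q))).det := by
      rw [← Matrix.det_transpose (Matrix.of fun q p => comul (R := k) (c p (J q)))]
      exact (Bialgebra.comulAlgHom k B).map_det _
    have e2 : (Matrix.of fun q p => comul (R := k) (c p (J q))) =
        fun q => ∑ l, ((1 : B) ⊗ₜ[k] antipode k (ρ (J q) l)) •
          fun p => relationTranslate (k := k) ρ (c p) l := by
      ext q p
      rw [Matrix.of_apply, comul_eq_sum_relationTranslate h hv (c p) (J q), Finset.sum_apply]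
      rfl
    rw [e, e2]
    change tensorSlice B m (Matrix.detRowAlternating.toMultilinearMap _) ∈ _
    rw [MultilinearMap.map_sum, map_sum]
    refine Submodule.sum_mem _ fun r _ => ?_
    rw [MultilinearMap.map_smul_univ]
    have e3 : (∏ q, (1 : B) ⊗ₜ[k] antipode k (ρ (J q) (r q))) =
        (1 : B) ⊗ₜ[k] ∏ q, antipode k (ρ (J q) (r q)) :=
      (map_prod (Algebra.TensorProduct.includeRight : B →ₐ[k] B ⊗[k] B) _ _).symm
    rw [e3, smul_eq_mul, tensorSlice_mul, one_mul]
    have e4 : Matrix.detRowAlternating.toMultilinearMap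
        (fun q p => relationTranslate (k := k) ρ (c p) (r q)) =
        (Matrix.of fun p q => relationTranslate (k := k) ρ (c p) (r q)).det :=
      Matrix.det_transpose (Matrix.of fun p q => relationTranslate (k := k) ρ (c p) (r q))
    rw [e4]
    exact tensorSlice_det_relationTranslate_mem hS h c hc r _
  | zero => simp
  | add x y _ _ hx hy => intro m; simpa using add_mem (hx m) (hy m)
  | smul a x _ hx =>
    intro m
    obtain ⟨z, hz⟩ := hS.comul_mem a a.2
    obtain ⟨n, l, b, hzb⟩ := exists_eq_sum_tensorSlice_tmul_single z
    rw [Subalgebra.smul_def, smul_eq_mul, Bialgebra.comul_mul, ← hz, hzb, map_sum,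
      Finset.sum_mul, map_sum]
    refine Submodule.sum_mem _ fun j _ => ?_
    have := Submodule.smul_mem (relationMinors S v s) (tensorSlice S (l j) z)
      (hx (m ∘ₗ LinearMap.mulLeft k (b j : B)))
    rw [Subalgebra.smul_def, smul_eq_mul, ← tensorSlice_mul] at this
    exact this

/-- If the `(s + 1)`-minors of relations vanish, Cramer's rule turns each `s`-minor `D` into a
tuple `t` over `S` with `∑ c_i t_i = D ∑ c_i v_i` for all relations `c`. -/
theorem exists_solution_of_mem_relationMinors (S : Subalgebra k B) (v : ι → B) (s : ℕ)
    (h0 : ∀ x ∈ relationMinors S v (s + 1), x = 0) (D : B) (hD : D ∈ relationMinors S v s) :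
    ∃ t : ι → B, (∀ i, t i ∈ S) ∧
      ∀ c, IsRelationMod S v c → ∑ i, c i * t i = D * ∑ i, c i * v i := by
  classical
  induction hD using Submodule.span_induction with
  | zero => exact ⟨0, fun i => S.zero_mem, fun c hc => by simp⟩
  | add x y _ _ hx hy =>
    obtain ⟨t, ht, h⟩ := hx
    obtain ⟨t', ht', h'⟩ := hy
    refine ⟨t + t', fun i => S.add_mem (ht i) (ht' i), fun c hc => ?_⟩
    simp only [Pi.add_apply, mul_add, Finset.sum_add_distrib, add_mul, h c hc, h' c hc]
  | smul a x _ hx =>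
    obtain ⟨t, ht, h⟩ := hx
    refine ⟨fun i => a * t i, fun i => S.mul_mem a.2 (ht i), fun c hc => ?_⟩
    rw [Subalgebra.smul_def, smul_eq_mul, mul_assoc, ← h c hc, Finset.mul_sum]
    exact Finset.sum_congr rfl fun i _ => by ring
  | mem D hD =>
    obtain ⟨r, hr, J, rfl⟩ := hD
    -- `N q w` is the minor in which column `q` is removed and the column `w` is put in front.
    let N : Fin s → (Fin s → B) → B := fun q w =>
      (Matrix.of fun p (q' : Fin s) =>
        (Fin.cons (w p) (fun j => r p (J j)) : Fin (s + 1) → B) (q.succ.succAbove q')).det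
    have hNlin : ∀ q, ∃ f : (Fin s → B) →ₗ[B] B, ∀ w, N q w = f w := by
      intro q
      obtain ⟨s', rfl⟩ := Nat.exists_eq_succ_of_ne_zero q.pos.ne'
      refine ⟨LinearMap.proj 0 ∘ₗ Matrix.cramer (Matrix.of fun p q' =>
        (Fin.cons 0 (fun j => r p (J j)) : Fin (s' + 1 + 1) → B) (q.succ.succAbove q')),
        fun w => ?_⟩
      rw [LinearMap.comp_apply, LinearMap.proj_apply, Matrix.cramer_apply]
      refine congrArg Matrix.det ?_
      ext p q'
      cases q' using Fin.cases with
      | zero => simp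
      | succ q' => simp [Fin.succ_succAbove_succ]
    have hNmem : ∀ q w, (∀ p, w p ∈ S) → N q w ∈ S := by
      intro q w hw
      refine det_mem_subalgebra S _ fun p q' => ?_
      rw [Matrix.of_apply]
      cases q.succ.succAbove q' using Fin.cases with
      | zero => exact hw p
      | succ j => exact (hr p).mem _
    have hlaplace : ∀ c, IsRelationMod S v c → ∀ i,
        c i * (Matrix.of fun p q => r p (J q)).det =
          ∑ q : Fin s, c (J q) * ((-1) ^ (q : ℕ) * N q fun p => r p i) := by
      intro c hc i
      have hz := h0 _ (Submodule.subset_span ⟨(Fin.cons c r : Fin (s + 1) → ι → B),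
        Fin.cases hc hr, (Fin.cons i J : Fin (s + 1) → ι), rfl⟩)
      rw [Matrix.det_succ_row_zero, Fin.sum_univ_succ] at hz
      have hN : ∀ q : Fin s, N q (fun p => r p i) =
          ((Matrix.of fun p q => (Fin.cons c r : Fin (s + 1) → ι → B) p
            ((Fin.cons i J : Fin (s + 1) → ι) q)).submatrix Fin.succ q.succ.succAbove).det := by
        intro q
        refine congrArg Matrix.det ?_
        ext p q'
        simp only [Matrix.of_apply, Matrix.submatrix_apply, Fin.cons_succ]
        cases q.succ.succAbove q' using Fin.cases with
        | zero => rfl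
        | succ j => rfl
      simp_rw [hN]
      have h1 : ((Matrix.of fun p q => (Fin.cons c r : Fin (s + 1) → ι → B) p
            ((Fin.cons i J : Fin (s + 1) → ι) q)).submatrix Fin.succ (Fin.succAbove 0)) =
          Matrix.of fun p q => r p (J q) := by
        ext p q
        simp
      rw [h1] at hz
      simp only [Matrix.of_apply, Fin.cons_zero, Fin.cons_succ, Fin.val_zero, pow_zero, one_mul,
        Fin.val_succ] at hz
      rw [eq_neg_of_add_eq_zero_left hz, ← Finset.sum_neg_distrib]
      exact Finset.sum_congr rfl fun q _ => by ring
    refine ⟨fun i => ∑ q, if J q = i then (-1) ^ (q : ℕ) * N q (fun p => ∑ j, r p j * v j) else 0,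
      fun i => S.sum_mem fun q _ => ?_, fun c hc => ?_⟩
    · split_ifs
      · exact S.mul_mem (S.pow_mem (S.neg_mem S.one_mem) _) (hNmem q _ fun p => (hr p).sum_mem)
      · exact S.zero_mem
    · simp_rw [Finset.mul_sum, mul_ite, mul_zero]
      rw [Finset.sum_comm]
      simp_rw [Finset.sum_ite_eq, Finset.mem_univ, if_true]
      have hr' : ∀ i, (Matrix.of fun p q => r p (J q)).det * (c i * v i) =
          ∑ q : Fin s, c (J q) * ((-1) ^ (q : ℕ) * N q fun p => r p i) * v i := by
        intro i
        rw [← Finset.sum_mul, ← hlaplace c hc i]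
        ring
      simp_rw [hr']
      rw [Finset.sum_comm]
      refine Finset.sum_congr rfl fun q _ => ?_
      obtain ⟨f, hf⟩ := hNlin q
      have hγ : (fun p => ∑ j, r p j * v j) = ∑ j, v j • fun p => r p j := by
        ext p
        simp [mul_comm]
      rw [hf, hγ, map_sum, Finset.mul_sum, Finset.mul_sum]
      refine Finset.sum_congr rfl fun j _ => ?_
      rw [hf, map_smul, smul_eq_mul]
      ring

/-- The retraction onto a Hopf subalgebra `S ⊆ B`: each finite family `y` in `B` can be replaced
by a family `t` in `S` satisfying the same inhomogeneous linear relations over `S`. That is, the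
inclusion `S → B` is pure. For `y` spanning a subcomodule, the Fitting ideals of the `S`-module
generated by `y` modulo `S` are translation stable, hence `0` or the unit ideal, which makes
Cramer's rule available. -/
theorem IsHopfSubalgebra.exists_retraction {S : Subalgebra k B} (hS : IsHopfSubalgebra S)
    (y : ι → B) :
    ∃ t : ι → B, (∀ i, t i ∈ S) ∧
      ∀ c, IsRelationMod S y c → ∑ i, c i * t i = ∑ i, c i * y i := by
  classical
  obtain ⟨V, hfin, hyV, hV⟩ := exists_finiteDimensional_subcomodule (k := k)
    (Finset.univ.image y)
  let b := Module.finBasis k V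
  let v : Fin (Module.finrank k V) → B := fun i => b i
  have hv : LinearIndependent k v :=
    b.linearIndependent.map' V.subtype (Submodule.ker_subtype V)
  have hspan : Submodule.span k (Set.range v) = V := by
    have : Set.range v = V.subtype '' Set.range b := by rw [← Set.range_comp]; rfl
    rw [this, Submodule.span_image, b.span_eq, Submodule.map_top, Submodule.range_subtype]
  obtain ⟨ρ, hρ⟩ := exists_isCoactionMatrix (k := k) v fun j l => by
    rw [hspan]
    exact hV _ (b j).2 l
  obtain ⟨t, htS, ht⟩ : ∃ t : Fin (Module.finrank k V) → B, (∀ i, t i ∈ S) ∧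
      ∀ c, IsRelationMod S v c → ∑ i, c i * t i = ∑ i, c i * v i := by
    have hex : ∃ s, ∀ x ∈ relationMinors S v s, x = 0 := by
      refine ⟨Module.finrank k V + 1, fun x hx => ?_⟩
      induction hx using Submodule.span_induction with
      | mem x hx =>
        obtain ⟨c, hc, J, rfl⟩ := hx
        obtain ⟨p, q, hpq, hJ⟩ := Fintype.exists_ne_map_eq_of_card_lt J (by simp)
        exact Matrix.det_zero_of_column_eq hpq fun i => by simp [hJ]
      | zero => rfl
      | add x y _ _ hx hy => rw [hx, hy, add_zero]
      | smul a x _ hx => rw [hx, smul_zero]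
    obtain ⟨s, hs⟩ : ∃ s, Nat.find hex = s + 1 := by
      refine Nat.exists_eq_succ_of_ne_zero fun h => ?_
      have h0 := Nat.find_spec hex
      rw [h] at h0
      have h1 : (1 : B) = 0 := h0 1 (Submodule.subset_span ⟨Fin.elim0, fun p => p.elim0, Fin.elim0,
        by simp⟩)
      have h2 := congrArg (counit (R := k)) h1
      simp at h2
    have h0 : ∀ x ∈ relationMinors S v (s + 1), x = 0 := hs ▸ Nat.find_spec hex
    obtain ⟨x, hx, hx0⟩ : ∃ x ∈ relationMinors S v s, x ≠ 0 := by
      have := Nat.find_min hex (m := s) (by omega)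
      push Not at this
      exact this
    have h1 := hS.one_mem_of_stable (relationMinors S v s) (relationMinors_le S v s)
      (tensorSlice_comul_relationMinors_mem hS hρ hv s) hx hx0
    obtain ⟨t, ht, h⟩ := exists_solution_of_mem_relationMinors S v s h0 1 h1
    exact ⟨t, ht, fun c hc => by rw [h c hc, one_mul]⟩
  have hy : ∀ i, ∃ a : Fin (Module.finrank k V) → k, ∑ j, a j • v j = y i := by
    intro i
    rw [← Submodule.mem_span_range_iff_exists_fun, hspan]
    exact hyV (by simp)
  choose a ha using hy
  have hcomb : ∀ (c : ι → B) (w : Fin (Module.finrank k V) → B),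
      ∑ i, c i * ∑ j, a i j • w j = ∑ j, (∑ i, a i j • c i) * w j := by
    intro c w
    simp_rw [Finset.mul_sum, Finset.sum_mul]
    rw [Finset.sum_comm]
    exact Finset.sum_congr rfl fun j _ => Finset.sum_congr rfl fun i _ => by
      rw [mul_smul_comm, smul_mul_assoc]
  refine ⟨fun i => ∑ j, a i j • t j, fun i => S.sum_mem fun j _ => S.smul_mem (htS j) _,
    fun c hc => ?_⟩
  have hc' := hc.sum_mem
  simp_rw [← ha] at hc' ⊢
  rw [hcomb] at hc' ⊢
  rw [hcomb]
  exact ht _ ⟨fun j => S.sum_mem fun i _ => S.smul_mem (hc.mem i) _, hc'⟩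

end Retraction

/-! ### Twisted chains of polynomial ideals -/

section TwistedNoetherian

open MvPolynomial MonomialOrder

open scoped MonomialOrder

variable {k ι : Type*} [Field k]

theorem MonomialOrder.degree_map_of_injective (m : MonomialOrder ι) {σ : k →+* k}
    (f : MvPolynomial ι k) : m.degree (MvPolynomial.map σ f) = m.degree f := by
  unfold MonomialOrder.degree
  rw [support_map_of_injective f σ.injective]

/-- The noetherian property of polynomial rings for chains of ideals that are only ascending up to
a twist of the coefficients by an endomorphism `σ` of the field: if `σ(J_i) ⊆ J_{i+1}` for all `i`,
then eventually `J_{i+1}` is generated by `σ(J_i)`. The exponents of leading monomials do not see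
the twist, so that they give an ascending chain of monomial ideals. -/
theorem exists_forall_ge_eq_map_of_twisted_chain [Finite ι] (m : MonomialOrder ι) (σ : k →+* k)
    (J : ℕ → Ideal (MvPolynomial ι k)) (hJ : ∀ i, (J i).map (MvPolynomial.map σ) ≤ J (i + 1)) :
    ∃ n, ∀ i ≥ n, J (i + 1) = (J i).map (MvPolynomial.map σ) := by
  classical
  let E : ℕ → Set (ι →₀ ℕ) := fun i => {d | ∃ f ∈ J i, f ≠ 0 ∧ m.degree f = d}
  have hE : Monotone E := monotone_nat_of_le_succ fun i => by
    rintro _ ⟨f, hf, hf0, rfl⟩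
    exact ⟨MvPolynomial.map σ f, hJ i (Ideal.mem_map_of_mem _ hf),
      (map_ne_zero_iff _ (map_injective σ σ.injective)).2 hf0, m.degree_map_of_injective f⟩
  let M : ℕ →o Ideal (MvPolynomial ι k) :=
    ⟨fun i => Ideal.span ((fun s => monomial s (1 : k)) '' E i), fun i j hij =>
      Ideal.span_mono (Set.image_mono (hE hij))⟩
  obtain ⟨n, hn⟩ := monotone_stabilizes_iff_noetherian.2
    (inferInstance : IsNoetherianRing (MvPolynomial ι k)) M
  refine ⟨n, fun i hi => le_antisymm ?_ (hJ i)⟩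
  have hEi : E (i + 1) ⊆ E i := by
    intro d hd
    have h1 : (monomial d (1 : k)) ∈ M (i + 1) := Ideal.subset_span ⟨d, hd, rfl⟩
    rw [← hn (i + 1) (by omega), hn i hi] at h1
    obtain ⟨e, ⟨g, hg, hg0, rfl⟩, hed⟩ :=
      mem_ideal_span_monomial_image.1 h1 d (by simp [mem_support_iff])
    have hmon : monomial (d - m.degree g) (1 : k) ≠ 0 := by simp
    refine ⟨monomial (d - m.degree g) 1 * g, (J i).mul_mem_left _ hg, mul_ne_zero hmon hg0, ?_⟩
    rw [m.degree_mul hmon hg0, m.degree_monomial, if_neg one_ne_zero, tsub_add_cancel_of_le hed]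
  have key : ∀ (a : m.syn) (f : MvPolynomial ι k), m.toSyn (m.degree f) = a → f ∈ J (i + 1) →
      f ∈ (J i).map (MvPolynomial.map σ) := by
    intro a
    induction a using WellFoundedLT.induction with
    | ind a ih =>
      intro f hfa hf
      by_cases hf0 : f = 0
      · rw [hf0]; exact zero_mem _
      obtain ⟨g, hg, hg0, hgf⟩ := hEi ⟨f, hf, hf0, rfl⟩
      set g' := MvPolynomial.map σ g with hg'
      have hg'0 : g' ≠ 0 := (map_ne_zero_iff _ (map_injective σ σ.injective)).2 hg0
      have hdeg : m.degree g' = m.degree f := (m.degree_map_of_injective g).trans hgf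
      have hmem : g' ∈ (J i).map (MvPolynomial.map σ) := Ideal.mem_map_of_mem _ hg
      set c := m.leadingCoeff f / m.leadingCoeff g' with hc
      set h := f - C c * g' with hh
      have hhJ : h ∈ J (i + 1) := sub_mem hf (Ideal.mul_mem_left _ _ (hJ i hmem))
      have hsub : h ∈ (J i).map (MvPolynomial.map σ) := by
        by_cases hh0 : h = 0
        · rw [hh0]; exact zero_mem _
        refine ih _ ?_ h rfl hhJ
        rw [← hfa]
        have hcoeff : h.coeff (m.degree f) = 0 := by
          have hne : m.leadingCoeff g' ≠ 0 := m.leadingCoeff_ne_zero_iff.2 hg'0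
          rw [hh, coeff_sub, coeff_C_mul, hc]
          have e1 : g'.coeff (m.degree f) = m.leadingCoeff g' := by
            rw [← hdeg]; rfl
          rw [e1, div_mul_cancel₀ _ hne]
          exact sub_self _
        have hle : m.degree h ≼[m] m.degree f := by
          rw [m.degree_le_iff]
          intro d hd
          rcases Finset.mem_union.1 (support_sub ι f (C c * g') hd) with hd | hd
          · exact m.le_degree hd
          · rw [← hdeg]
            refine m.le_degree ?_
            rw [mem_support_iff, coeff_C_mul] at hd
            exact mem_support_iff.2 (right_ne_zero_of_mul hd)
        refine lt_of_le_of_ne hle fun heq => ?_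
        rw [← m.toSyn.injective heq] at hcoeff
        exact m.coeff_degree_ne_zero_iff.2 hh0 hcoeff
      have : f = h + C c * g' := by rw [hh]; ring
      rw [this]
      exact add_mem hsub (Ideal.mul_mem_left _ _ hmem)
  exact fun f hf => key _ f rfl hf

end TwistedNoetherian

/-! ### Detecting elements after a pure base change -/

section Descent

/-- If finite families in `B` can be replaced by families in `R` satisfying the same inhomogeneous
linear relations over `A`, then `R → R ⊗ B` is injective. -/
theorem eq_zero_of_tmul_one_eq_zero {A R B : Type*} [CommRing A] [CommRing R] [CommRing B]
    [Algebra A R] [Algebra A B]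
    (h : ∀ (n : ℕ) (y : Fin n → B), ∃ t : Fin n → R, ∀ (c : Fin n → A) (a : A),
      ∑ i, c i • y i = algebraMap A B a → ∑ i, c i • t i = algebraMap A R a)
    (r : R) (hr : (1 : B) ⊗ₜ[A] r = 0) : r = 0 := by
  classical
  have h1 : (Submodule.span A {(1 : B)}).FG := Submodule.fg_span_singleton _
  have hone : (1 : B) ∈ Submodule.span A {(1 : B)} := Submodule.mem_span_singleton_self _
  obtain ⟨Q, hPQ, hQ, h0⟩ := TensorProduct.eq_zero_of_fg_of_subtype_eq_zero h1
    (t := (⟨1, hone⟩ : Submodule.span A {(1 : B)}) ⊗ₜ[A] r) (by simpa using hr)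
  obtain ⟨n, y, hy⟩ := Submodule.fg_iff_exists_fin_generating_family.1 hQ
  obtain ⟨t, ht⟩ := h n y
  let p : (Fin n → A) →ₗ[A] B := Fintype.linearCombination A y
  let q : (Fin n → A) →ₗ[A] R := Fintype.linearCombination A t
  have hpQ : LinearMap.range p = Q := by
    rw [← hy]
    exact Fintype.range_linearCombination A y
  subst hpQ
  have hker : LinearMap.ker p ≤ LinearMap.ker q := by
    intro c hc
    have := ht c 0 (by rw [map_zero]; exact hc)
    rwa [map_zero] at this
  let s : LinearMap.range p →ₗ[A] R :=
    (LinearMap.ker p).liftQ q hker ∘ₗ p.quotKerEquivRange.symm.toLinearMap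
  have hs : s ⟨1, hPQ hone⟩ = 1 := by
    obtain ⟨c, hc⟩ := hPQ hone
    have e : (⟨1, hPQ hone⟩ : LinearMap.range p) = p.quotKerEquivRange ((LinearMap.ker p).mkQ c) :=
      Subtype.ext hc.symm
    rw [e]
    simp only [s, LinearMap.comp_apply, LinearEquiv.coe_coe, LinearEquiv.symm_apply_apply]
    rw [Submodule.mkQ_apply, Submodule.liftQ_apply]
    exact (ht c 1 (by rw [map_one]; exact hc)).trans (map_one _)
  have h2 := congrArg (fun z => LinearMap.mul' A R (s.rTensor R z)) h0
  simp only [LinearMap.rTensor_tmul, map_zero, LinearMap.mul'_apply] at h2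
  rw [← one_mul r, ← hs]
  exact h2

end Descent

/-! ### Comparing ideals along a Hopf subalgebra -/

section Comparison

variable {k A : Type*} [Field k] [CommRing A] [HopfAlgebra k A]

open Coalgebra HopfAlgebra

/-- The image of a Hopf subalgebra in a quotient Hopf algebra is a Hopf subalgebra. -/
theorem IsHopfSubalgebra.map_mk {S : Subalgebra k A} (hS : IsHopfSubalgebra S) (I : Ideal A)
    [I.IsHopfIdeal k] : IsHopfSubalgebra (S.map (Ideal.Quotient.mkₐ k I)) where
  comul_mem := by
    rintro _ ⟨a, ha, rfl⟩
    obtain ⟨z, hz⟩ := hS.comul_mem a ha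
    have e : comul (R := k) (Ideal.Quotient.mkₐ k I a) =
        Algebra.TensorProduct.map (Ideal.Quotient.mkₐ k I) (Ideal.Quotient.mkₐ k I)
          (comul (R := k) a) := rfl
    rw [AlgHom.coe_toRingHom, e, ← hz]
    clear hz
    induction z with
    | zero => simp
    | tmul x y =>
      exact ⟨(⟨_, Subalgebra.mem_map.2 ⟨x, x.2, rfl⟩⟩ : S.map (Ideal.Quotient.mkₐ k I)) ⊗ₜ
        (⟨_, Subalgebra.mem_map.2 ⟨y, y.2, rfl⟩⟩ : S.map (Ideal.Quotient.mkₐ k I)), rfl⟩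
    | add x y hx hy =>
      rw [map_add, map_add]
      exact add_mem hx hy
  antipode_mem := by
    rintro _ ⟨a, ha, rfl⟩
    exact Subalgebra.mem_map.2 ⟨antipode k a, hS.antipode_mem a ha, rfl⟩

/-- Let `I` be a Hopf ideal and `I'` an ideal stable under translation by the closed subgroup
defined by `I`, such that `I` and `I'` agree on a Hopf subalgebra `S`. If a translation stable
subspace `U ⊆ I` lies in `I'` modulo the augmentation ideal of `S`, then `U ⊆ I'`.

In terms of groups: for a point `g` of the closed subscheme defined by `I'` and a point `h` of the
subgroup defined by `I` with the same image in the spectrum of `S`, the quotient `g h⁻¹` is in the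
kernel, where the functions in `U` vanish; so they vanish at `g = (g h⁻¹) h`. Such an `h` exists
after a base change which is pure by `IsHopfSubalgebra.exists_retraction`. -/
theorem IsHopfSubalgebra.le_of_le_sup_augmentation {S : Subalgebra k A} (hS : IsHopfSubalgebra S)
    (I I' : Ideal A) [I.IsHopfIdeal k]
    (hI' : ∀ a ∈ I', Algebra.TensorProduct.map (Ideal.Quotient.mkₐ k I') (Ideal.Quotient.mkₐ k I)
      (comul (R := k) a) = 0)
    (hIS : ∀ a ∈ I, a ∈ S → a ∈ I') (U : Submodule k A)
    (hU : ∀ u ∈ U, ∀ l : A ⧸ I →ₗ[k] k, tensorSlice A l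
      (Algebra.TensorProduct.map (AlgHom.id k A) (Ideal.Quotient.mkₐ k I) (comul (R := k) u)) ∈ U)
    (hU' : ∀ u ∈ U, u ∈ I' ⊔ Ideal.span {a | a ∈ S ∧ counit (R := k) a = 0}) :
    ∀ u ∈ U, u ∈ I' := by
  classical
  -- The universal pair `(g, h)` has values in `E`.
  let E := (A ⧸ I) ⊗[S] (A ⧸ I')
  let p' : A ⧸ I' →ₐ[k] E :=
    (Algebra.TensorProduct.includeRight : A ⧸ I' →ₐ[S] E).restrictScalars k
  let q' : A ⧸ I →ₐ[k] E :=
    (Algebra.TensorProduct.includeLeft : A ⧸ I →ₐ[S] E).restrictScalars k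
  let p : A →ₐ[k] E := p'.comp (Ideal.Quotient.mkₐ k I')
  let q : A →ₐ[k] E := q'.comp (Ideal.Quotient.mkₐ k I)
  have hpq : ∀ b ∈ S, p b = q b := by
    intro b hb
    have e1 : p b = algebraMap S E ⟨b, hb⟩ :=
      (Algebra.TensorProduct.includeRight : A ⧸ I' →ₐ[S] E).commutes ⟨b, hb⟩
    have e2 : q b = algebraMap S E ⟨b, hb⟩ :=
      (Algebra.TensorProduct.includeLeft : A ⧸ I →ₐ[S] E).commutes ⟨b, hb⟩
    rw [e1, e2]
  let D : A →ₐ[k] E := (Algebra.TensorProduct.lift p (q.comp (antipodeAlgHom k A))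
    (fun _ _ => Commute.all _ _)).comp (Bialgebra.comulAlgHom k A)
  have hDI' : ∀ a ∈ I', D a = 0 := by
    intro a ha
    have e : (Algebra.TensorProduct.lift p (q.comp (antipodeAlgHom k A))
        (fun _ _ => Commute.all _ _)) =
        (Algebra.TensorProduct.lift p' (q'.comp (antipodeAlgHom k (A ⧸ I)))
          (fun _ _ => Commute.all _ _)).comp
          (Algebra.TensorProduct.map (Ideal.Quotient.mkₐ k I') (Ideal.Quotient.mkₐ k I)) := by
      ext x
      · simp [p]
      · simp [q]
    change Algebra.TensorProduct.lift p (q.comp (antipodeAlgHom k A))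
      (fun _ _ => Commute.all _ _) (comul (R := k) a) = 0
    rw [e, AlgHom.comp_apply, hI' a ha, map_zero]
  have hDS : ∀ b ∈ S, D b = algebraMap k E (counit (R := k) b) := by
    intro b hb
    obtain ⟨z, hz⟩ := hS.comul_mem b hb
    have e : ∀ z : S ⊗[k] S, Algebra.TensorProduct.lift p (q.comp (antipodeAlgHom k A))
        (fun _ _ => Commute.all _ _) (Algebra.TensorProduct.map S.val S.val z) =
        q (LinearMap.mul' k A ((antipode k).lTensor A (Algebra.TensorProduct.map S.val S.val z))) := by
      intro z
      induction z with
      | zero => simp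
      | tmul x y => simp [hpq x x.2]
      | add x y hx hy => simp only [map_add, hx, hy]
    change Algebra.TensorProduct.lift p (q.comp (antipodeAlgHom k A))
      (fun _ _ => Commute.all _ _) (comul (R := k) b) = _
    rw [← hz]
    refine (e z).trans ?_
    have hz' : Algebra.TensorProduct.map S.val S.val z = comul (R := k) b := hz
    rw [hz', mul_antipode_lTensor_comul_apply, AlgHom.commutes]
  have hDU : ∀ u ∈ U, D u = 0 := by
    intro u hu
    have hle : I' ⊔ Ideal.span {a | a ∈ S ∧ counit (R := k) a = 0} ≤ RingHom.ker D.toRingHom := by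
      refine sup_le (fun a ha => hDI' a ha) (Ideal.span_le.2 ?_)
      rintro a ⟨ha, ha0⟩
      change D a = 0
      rw [hDS a ha, ha0, map_zero]
    exact hle (hU' u hu)
  -- `D` is `g h⁻¹`, so that multiplying it with `h` gives back `g`.
  have hDq : (Algebra.TensorProduct.lift D q (fun _ _ => Commute.all _ _)).comp
      (Bialgebra.comulAlgHom k A) = p := by
    have e1 : ∀ z : A ⊗[k] A, Algebra.TensorProduct.lift D q (fun _ _ => Commute.all _ _) z =
        LinearMap.mul' k E (TensorProduct.map p.toLinearMap
          (q.toLinearMap ∘ₗ LinearMap.mul' k A ∘ₗ (antipode k).rTensor A)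
            (TensorProduct.assoc k A A A (comul.rTensor A z))) := by
      have e2 : ∀ (w : A ⊗[k] A) (y : A),
          Algebra.TensorProduct.lift p (q.comp (antipodeAlgHom k A))
            (fun _ _ => Commute.all _ _) w * q y =
          LinearMap.mul' k E (TensorProduct.map p.toLinearMap
          (q.toLinearMap ∘ₗ LinearMap.mul' k A ∘ₗ (antipode k).rTensor A)
            (TensorProduct.assoc k A A A (w ⊗ₜ y))) := by
        intro w y
        induction w with
        | zero => simp
        | tmul a b => simp [mul_assoc]
        | add a b ha hb => simp only [map_add, add_mul, add_tmul, ha, hb]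
      intro z
      induction z with
      | zero => simp
      | tmul a b =>
        rw [Algebra.TensorProduct.lift_tmul, LinearMap.rTensor_tmul, ← e2]
        rfl
      | add a b ha hb => simp only [map_add, ha, hb]
    ext a
    rw [AlgHom.comp_apply, Bialgebra.comulAlgHom_apply, e1, coassoc_apply]
    have e3 : ∀ z : A ⊗[k] A, TensorProduct.map p.toLinearMap
        (q.toLinearMap ∘ₗ LinearMap.mul' k A ∘ₗ (antipode k).rTensor A) (comul.lTensor A z) =
        TensorProduct.map p.toLinearMap (Algebra.linearMap k E) (counit.lTensor A z) := by
      intro z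
      induction z with
      | zero => simp
      | tmul a b =>
        simp only [LinearMap.lTensor_tmul, TensorProduct.map_tmul, LinearMap.comp_apply,
          mul_antipode_rTensor_comul_apply, AlgHom.toLinearMap_apply, AlgHom.commutes,
          Algebra.linearMap_apply]
      | add a b ha hb => simp only [map_add, ha, hb]
    rw [e3, lTensor_counit_comul]
    simp
  intro u hu
  have hpu : p u = 0 := by
    rw [← hDq]
    have e : Algebra.TensorProduct.lift D q (fun _ _ => Commute.all _ _) =
        (Algebra.TensorProduct.lift D q' (fun _ _ => Commute.all _ _)).comp
          (Algebra.TensorProduct.map (AlgHom.id k A) (Ideal.Quotient.mkₐ k I)) := by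
      ext x
      · simp
      · simp [q]
    rw [AlgHom.comp_apply, e, AlgHom.comp_apply, Bialgebra.comulAlgHom_apply]
    obtain ⟨n, l, b, hx⟩ := exists_eq_sum_tensorSlice_tmul_single
      (Algebra.TensorProduct.map (AlgHom.id k A) (Ideal.Quotient.mkₐ k I) (comul (R := k) u))
    rw [hx, map_sum]
    refine Finset.sum_eq_zero fun j _ => ?_
    rw [Algebra.TensorProduct.lift_tmul, hDU _ (hU u hu _), zero_mul]
  have hret : ∀ (n : ℕ) (y : Fin n → A ⧸ I), ∃ t : Fin n → A ⧸ I', ∀ (c : Fin n → S) (a : S),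
      ∑ i, c i • y i = algebraMap S (A ⧸ I) a → ∑ i, c i • t i = algebraMap S (A ⧸ I') a := by
    intro n y
    obtain ⟨t, ht, h⟩ := (hS.map_mk I).exists_retraction y
    choose t' ht'S ht' using fun i => Subalgebra.mem_map.1 (ht i)
    refine ⟨fun i => Ideal.Quotient.mk I' (t' i), fun c a hca => ?_⟩
    have h1 : ∑ i, Ideal.Quotient.mk I (c i : A) * y i = Ideal.Quotient.mk I (a : A) := hca
    have h2 := h (fun i => Ideal.Quotient.mk I (c i : A))
      ⟨fun i => Subalgebra.mem_map.2 ⟨c i, (c i).2, rfl⟩,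
        h1 ▸ Subalgebra.mem_map.2 ⟨a, a.2, rfl⟩⟩
    rw [h1] at h2
    have h3 : Ideal.Quotient.mk I (∑ i, (c i : A) * t' i) = Ideal.Quotient.mk I (a : A) := by
      rw [map_sum, ← h2]
      refine Finset.sum_congr rfl fun i _ => ?_
      rw [map_mul, ← ht' i]
      rfl
    have h4 : Ideal.Quotient.mk I' (∑ i, (c i : A) * t' i) = Ideal.Quotient.mk I' (a : A) := by
      rw [Ideal.Quotient.eq] at h3 ⊢
      exact hIS _ h3 (S.sub_mem (S.sum_mem fun i _ => S.mul_mem (c i).2 (ht'S i)) a.2)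
    rw [map_sum] at h4
    exact h4
  have := eq_zero_of_tmul_one_eq_zero hret (Ideal.Quotient.mk I' u) hpu
  exact Ideal.Quotient.eq_zero_iff_mem.1 this

end Comparison

/-! ### Tensor products of semilinear ring homomorphisms -/

section SemilinearTensor

variable {k A B A' B' T : Type*} [CommRing k] [CommRing A] [CommRing B] [CommRing A']
  [CommRing B'] [CommRing T] [Algebra k A] [Algebra k B] [Algebra k A'] [Algebra k B']

/-- The ring homomorphism `a ⊗ b ↦ f a * g b` for ring homomorphisms `f` and `g` which agree on the
base ring; they need not be linear for a given algebra structure on the target. -/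
noncomputable def tensorLiftRingHom (f : A →+* T) (g : B →+* T)
    (h : ∀ c : k, f (algebraMap k A c) = g (algebraMap k B c)) : A ⊗[k] B →+* T :=
  letI : Algebra k T := (f.comp (algebraMap k A)).toAlgebra
  (Algebra.TensorProduct.lift (S := k) (⟨f, fun _ => rfl⟩ : A →ₐ[k] T)
    (⟨g, fun c => (h c).symm⟩ : B →ₐ[k] T) fun _ _ => Commute.all _ _).toRingHom

@[simp]
theorem tensorLiftRingHom_tmul (f : A →+* T) (g : B →+* T)
    (h : ∀ c : k, f (algebraMap k A c) = g (algebraMap k B c)) (a : A) (b : B) :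
    tensorLiftRingHom f g h (a ⊗ₜ b) = f a * g b :=
  letI : Algebra k T := (f.comp (algebraMap k A)).toAlgebra
  Algebra.TensorProduct.lift_tmul (S := k) (⟨f, fun _ => rfl⟩ : A →ₐ[k] T)
    (⟨g, fun c => (h c).symm⟩ : B →ₐ[k] T) (fun _ _ => Commute.all _ _) a b

/-- The tensor product of two `σ`-semilinear ring homomorphisms. -/
noncomputable def tensorMapRingHom {σ : k →+* k} (f : A →+* A') (g : B →+* B')
    (hf : ∀ c, f (algebraMap k A c) = algebraMap k A' (σ c))
    (hg : ∀ c, g (algebraMap k B c) = algebraMap k B' (σ c)) : A ⊗[k] B →+* A' ⊗[k] B' :=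
  tensorLiftRingHom
    ((Algebra.TensorProduct.includeLeft : A' →ₐ[k] A' ⊗[k] B').toRingHom.comp f)
    ((Algebra.TensorProduct.includeRight : B' →ₐ[k] A' ⊗[k] B').toRingHom.comp g)
    fun c => by
      simp only [RingHom.comp_apply, hf, hg, AlgHom.toRingHom_eq_coe, RingHom.coe_coe,
        AlgHom.commutes]

@[simp]
theorem tensorMapRingHom_tmul {σ : k →+* k} (f : A →+* A') (g : B →+* B')
    (hf : ∀ c, f (algebraMap k A c) = algebraMap k A' (σ c))
    (hg : ∀ c, g (algebraMap k B c) = algebraMap k B' (σ c)) (a : A) (b : B) :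
    tensorMapRingHom f g hf hg (a ⊗ₜ b) = f a ⊗ₜ g b := by
  simp [tensorMapRingHom]

theorem map_tensorMapRingHom {C D C' D' : Type*} [CommRing C] [CommRing D] [CommRing C']
    [CommRing D'] [Algebra k C] [Algebra k D] [Algebra k C'] [Algebra k D'] {σ : k →+* k}
    (f : A →+* A') (g : B →+* B') (f' : C →+* C') (g' : D →+* D')
    (hf : ∀ c, f (algebraMap k A c) = algebraMap k A' (σ c))
    (hg : ∀ c, g (algebraMap k B c) = algebraMap k B' (σ c))
    (hf' : ∀ c, f' (algebraMap k C c) = algebraMap k C' (σ c))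
    (hg' : ∀ c, g' (algebraMap k D c) = algebraMap k D' (σ c))
    (p : A →ₐ[k] C) (q : B →ₐ[k] D) (p' : A' →ₐ[k] C') (q' : B' →ₐ[k] D')
    (hp : ∀ a, p' (f a) = f' (p a)) (hq : ∀ b, q' (g b) = g' (q b)) (z : A ⊗[k] B) :
    Algebra.TensorProduct.map p' q' (tensorMapRingHom f g hf hg z) =
      tensorMapRingHom f' g' hf' hg' (Algebra.TensorProduct.map p q z) := by
  induction z with
  | zero => simp
  | tmul a b => simp [hp, hq]
  | add a b ha hb => simp only [map_add, ha, hb]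

end SemilinearTensor

/-! ### Finite generation of difference Hopf ideals -/

section FiniteGeneration

open Coalgebra HopfAlgebra

variable {k A : Type*} [Field k] [CommRing A] [HopfAlgebra k A]

/-- A ring endomorphism of a Hopf algebra, semilinear over an endomorphism `σ` of the base field
and compatible with the Hopf structure. -/
structure IsSemilinearHopfEnd (σ : k →+* k) (s : A →+* A) : Prop where
  map_algebraMap : ∀ c, s (algebraMap k A c) = algebraMap k A (σ c)
  comul_map : ∀ a, comul (R := k) (s a) =
    tensorMapRingHom s s map_algebraMap map_algebraMap (comul (R := k) a)
  counit_map : ∀ a, counit (R := k) (s a) = σ (counit (R := k) a)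
  antipode_map : ∀ a, antipode k (s a) = s (antipode k a)

theorem isHopfSubalgebra_adjoin {X : Set A}
    (hΔ : ∀ a ∈ X, comul (R := k) a ∈
      (Algebra.TensorProduct.map (Algebra.adjoin k X).val (Algebra.adjoin k X).val).range)
    (hS : ∀ a ∈ X, antipode k a ∈ Algebra.adjoin k X) :
    IsHopfSubalgebra (Algebra.adjoin k X) where
  comul_mem b hb := by
    have : Algebra.adjoin k X ≤ (Algebra.TensorProduct.map (Algebra.adjoin k X).val
        (Algebra.adjoin k X).val).range.comap (Bialgebra.comulAlgHom k A) :=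
      Algebra.adjoin_le hΔ
    exact this hb
  antipode_mem b hb := by
    have : Algebra.adjoin k X ≤ (Algebra.adjoin k X).comap (antipodeAlgHom k A) :=
      Algebra.adjoin_le hS
    exact this hb

/-- The subalgebra generated by the elements `s^j(x_l)` with `j ≤ i`. -/
def orderSubalgebra (k : Type*) {A : Type*} [Field k] [CommRing A] [Algebra k A] (s : A →+* A)
    {N : ℕ} (x : Fin N → A) (i : ℕ) : Subalgebra k A :=
  Algebra.adjoin k {a | ∃ j ≤ i, ∃ l, a = s^[j] (x l)}

section

variable {σ : k →+* k} {s : A →+* A} {N : ℕ} {x : Fin N → A}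

theorem orderSubalgebra_mono : Monotone (orderSubalgebra k s x) := fun i i' h => by
  refine Algebra.adjoin_mono ?_
  rintro a ⟨j, hj, l, rfl⟩
  exact ⟨j, hj.trans h, l, rfl⟩

theorem map_mem_orderSubalgebra (h : IsSemilinearHopfEnd σ s) {i : ℕ} {a : A}
    (ha : a ∈ orderSubalgebra k s x i) : s a ∈ orderSubalgebra k s x (i + 1) := by
  unfold orderSubalgebra at ha
  induction ha using Algebra.adjoin_induction with
  | mem a ha =>
    obtain ⟨j, hj, l, rfl⟩ := ha
    refine Algebra.subset_adjoin ⟨j + 1, by omega, l, ?_⟩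
    rw [Function.iterate_succ_apply']
  | algebraMap c =>
    rw [h.map_algebraMap]
    exact Subalgebra.algebraMap_mem _ _
  | add a b _ _ ha hb => rw [map_add]; exact add_mem ha hb
  | mul a b _ _ ha hb => rw [map_mul]; exact mul_mem ha hb

theorem map_comul_mem_range (h : IsSemilinearHopfEnd σ s) {S S' : Subalgebra k A}
    (hSS' : ∀ a ∈ S, s a ∈ S') {a : A}
    (ha : comul (R := k) a ∈ (Algebra.TensorProduct.map S.val S.val).range) :
    comul (R := k) (s a) ∈ (Algebra.TensorProduct.map S'.val S'.val).range := by
  obtain ⟨z, hz⟩ := ha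
  rw [h.comul_map, ← hz]
  clear hz
  induction z with
  | zero => simp
  | tmul x y =>
    exact ⟨(⟨s x, hSS' x x.2⟩ : S') ⊗ₜ (⟨s y, hSS' y y.2⟩ : S'), by simp⟩
  | add x y hx hy =>
    rw [map_add, map_add]
    exact add_mem hx hy

theorem range_map_val_mono {S S' : Subalgebra k A} (h : S ≤ S') :
    (Algebra.TensorProduct.map S.val S.val).range ≤
      (Algebra.TensorProduct.map S'.val S'.val).range := by
  rintro _ ⟨z, rfl⟩
  refine ⟨Algebra.TensorProduct.map (Subalgebra.inclusion h) (Subalgebra.inclusion h) z, ?_⟩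
  induction z with
  | zero => simp
  | tmul x y => simp
  | add x y hx hy => rw [map_add, map_add, hx, hy, map_add]

theorem isHopfSubalgebra_orderSubalgebra (h : IsSemilinearHopfEnd σ s)
    (hx : IsHopfSubalgebra (Algebra.adjoin k (Set.range x))) (i : ℕ) :
    IsHopfSubalgebra (orderSubalgebra k s x i) := by
  have h0 : Algebra.adjoin k (Set.range x) ≤ orderSubalgebra k s x 0 := by
    refine Algebra.adjoin_le ?_
    rintro _ ⟨l, rfl⟩
    exact Algebra.subset_adjoin ⟨0, le_rfl, l, rfl⟩
  have hj : ∀ j l, comul (R := k) (s^[j] (x l)) ∈ (Algebra.TensorProduct.map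
      (orderSubalgebra k s x j).val (orderSubalgebra k s x j).val).range ∧
      antipode k (s^[j] (x l)) ∈ orderSubalgebra k s x j := by
    intro j l
    have hxl : x l ∈ Algebra.adjoin k (Set.range x) := Algebra.subset_adjoin ⟨l, rfl⟩
    induction j with
    | zero =>
      exact ⟨range_map_val_mono h0 (hx.comul_mem _ hxl), h0 (hx.antipode_mem _ hxl)⟩
    | succ j ih =>
      rw [Function.iterate_succ_apply']
      refine ⟨map_comul_mem_range h (fun a ha => map_mem_orderSubalgebra h ha) ih.1, ?_⟩
      rw [h.antipode_map]
      exact map_mem_orderSubalgebra h ih.2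
  refine isHopfSubalgebra_adjoin ?_ ?_
  · rintro _ ⟨j, hji, l, rfl⟩
    exact range_map_val_mono (orderSubalgebra_mono hji) (hj j l).1
  · rintro _ ⟨j, hji, l, rfl⟩
    exact orderSubalgebra_mono hji (hj j l).2

theorem exists_mem_orderSubalgebra (h : IsSemilinearHopfEnd σ s)
    (hgen : ∀ S : Subalgebra k A, Set.range x ⊆ S → (∀ b ∈ S, s b ∈ S) → S = ⊤) (a : A) :
    ∃ i, a ∈ orderSubalgebra k s x i := by
  let S : Subalgebra k A := ⨆ i, orderSubalgebra k s x i
  have hdir : Directed (· ≤ ·) (orderSubalgebra k s x) := orderSubalgebra_mono.directed_le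
  have hmem : ∀ {b}, b ∈ S ↔ ∃ i, b ∈ orderSubalgebra k s x i := fun {b} => by
    rw [← SetLike.mem_coe, Subalgebra.coe_iSup_of_directed hdir, Set.mem_iUnion]
    rfl
  have hS : S = ⊤ := by
    refine hgen S ?_ fun b hb => ?_
    · rintro _ ⟨l, rfl⟩
      exact hmem.2 ⟨0, Algebra.subset_adjoin ⟨0, le_rfl, l, rfl⟩⟩
    · obtain ⟨i, hi⟩ := hmem.1 hb
      exact hmem.2 ⟨i + 1, map_mem_orderSubalgebra h hi⟩
  exact hmem.1 (hS ▸ Algebra.mem_top)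

theorem fg_orderSubalgebra (i : ℕ) : (orderSubalgebra k s x i).FG := by
  refine Subalgebra.fg_def.2 ⟨_, ?_, rfl⟩
  have : {a | ∃ j ≤ i, ∃ l, a = s^[j] (x l)} =
      (fun p : ℕ × Fin N => s^[p.1] (x p.2)) '' (Set.Iic i ×ˢ Set.univ) := by
    ext a
    constructor
    · rintro ⟨j, hj, l, rfl⟩
      exact ⟨(j, l), ⟨hj, trivial⟩, rfl⟩
    · rintro ⟨⟨j, l⟩, ⟨hj, -⟩, rfl⟩
      exact ⟨j, hj, l, rfl⟩
  rw [this]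
  exact ((Set.finite_Iic i).prod Set.finite_univ).image _

/-- The functions vanishing at the identity in the subalgebra of order `i`. -/
def augmentation (k : Type*) {A : Type*} [Field k] [CommRing A] [HopfAlgebra k A] (s : A →+* A)
    {N : ℕ} (x : Fin N → A) (i : ℕ) : Ideal A :=
  Ideal.span {a | a ∈ orderSubalgebra k s x i ∧ counit (R := k) a = 0}

theorem map_mem_augmentation (h : IsSemilinearHopfEnd σ s) {i : ℕ} {a : A}
    (ha : a ∈ augmentation k s x i) : s a ∈ augmentation k s x (i + 1) := by
  have : augmentation k s x i ≤ (augmentation k s x (i + 1)).comap s := by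
    refine Ideal.span_le.2 ?_
    rintro a ⟨ha, ha0⟩
    exact Ideal.subset_span ⟨map_mem_orderSubalgebra h ha, by rw [h.counit_map, ha0, map_zero]⟩
  exact this ha

theorem aeval_iterate_mem (i : ℕ) (p : MvPolynomial (Fin N) k) :
    MvPolynomial.aeval (fun l => s^[i] (x l)) p ∈ orderSubalgebra k s x i := by
  refine (Algebra.adjoin_le (S := orderSubalgebra k s x i) ?_ :
    Algebra.adjoin k (Set.range fun l => s^[i] (x l)) ≤ _) ?_
  · rintro _ ⟨l, rfl⟩
    exact Algebra.subset_adjoin ⟨i, le_rfl, l, rfl⟩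
  · rw [Algebra.adjoin_range_eq_range_aeval]
    exact ⟨p, rfl⟩

/-- Modulo functions of order `i` vanishing at the identity, functions of order `i + 1` are
polynomials in the new generators. -/
theorem exists_sub_aeval_mem_augmentation {i : ℕ} {a : A}
    (ha : a ∈ orderSubalgebra k s x (i + 1)) :
    ∃ p : MvPolynomial (Fin N) k,
      a - MvPolynomial.aeval (fun l => s^[i + 1] (x l)) p ∈ augmentation k s x i := by
  unfold orderSubalgebra at ha
  induction ha using Algebra.adjoin_induction with
  | mem a ha =>
    obtain ⟨j, hj, l, rfl⟩ := ha
    rcases Nat.of_le_succ hj with hj | rfl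
    · refine ⟨MvPolynomial.C (counit (R := k) (s^[j] (x l))), Ideal.subset_span ⟨?_, ?_⟩⟩
      · rw [MvPolynomial.aeval_C]
        exact sub_mem (Algebra.subset_adjoin ⟨j, hj, l, rfl⟩) (Subalgebra.algebraMap_mem _ _)
      · simp
    · exact ⟨MvPolynomial.X l, by simp⟩
  | algebraMap c => exact ⟨MvPolynomial.C c, by simp⟩
  | add a b _ _ ha hb =>
    obtain ⟨p, hp⟩ := ha
    obtain ⟨q, hq⟩ := hb
    refine ⟨p + q, ?_⟩
    rw [map_add, add_sub_add_comm]
    exact add_mem hp hq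
  | mul a b _ _ ha hb =>
    obtain ⟨p, hp⟩ := ha
    obtain ⟨q, hq⟩ := hb
    refine ⟨p * q, ?_⟩
    rw [map_mul]
    have e : a * b - MvPolynomial.aeval (fun l => s^[i + 1] (x l)) p *
        MvPolynomial.aeval (fun l => s^[i + 1] (x l)) q =
        b * (a - MvPolynomial.aeval (fun l => s^[i + 1] (x l)) p) +
        MvPolynomial.aeval (fun l => s^[i + 1] (x l)) p *
          (b - MvPolynomial.aeval (fun l => s^[i + 1] (x l)) q) := by ring
    rw [e]
    exact add_mem (Ideal.mul_mem_left _ _ hp) (Ideal.mul_mem_left _ _ hq)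

/-- The ideal of the kernel of the projection from order `i + 1` to order `i` of the closed subgroup
defined by `I`, as a subscheme of the affine space with the coordinates `s^(i+1)(x_l)`. -/
def kernelIdeal (k : Type*) {A : Type*} [Field k] [CommRing A] [HopfAlgebra k A] (s : A →+* A)
    {N : ℕ} (x : Fin N → A) (I : Ideal A) (i : ℕ) : Ideal (MvPolynomial (Fin N) k) where
  carrier := {p | ∃ u ∈ I, u ∈ orderSubalgebra k s x (i + 1) ∧
    MvPolynomial.aeval (fun l => s^[i + 1] (x l)) p - u ∈ augmentation k s x i}
  zero_mem' := ⟨0, I.zero_mem, zero_mem _, by simp⟩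
  add_mem' := by
    rintro p q ⟨u, hu, hu', hp⟩ ⟨w, hw, hw', hq⟩
    refine ⟨u + w, add_mem hu hw, add_mem hu' hw', ?_⟩
    rw [map_add, add_sub_add_comm]
    exact add_mem hp hq
  smul_mem' := by
    rintro r p ⟨u, hu, hu', hp⟩
    refine ⟨MvPolynomial.aeval (fun l => s^[i + 1] (x l)) r * u, I.mul_mem_left _ hu,
      mul_mem (aeval_iterate_mem (i + 1) r) hu', ?_⟩
    rw [smul_eq_mul, map_mul, ← mul_sub]
    exact Ideal.mul_mem_left _ _ hp

theorem aeval_map_iterate (h : IsSemilinearHopfEnd σ s) (i : ℕ) (p : MvPolynomial (Fin N) k) :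
    MvPolynomial.aeval (fun l => s^[i + 1] (x l)) (MvPolynomial.map σ p) =
      s (MvPolynomial.aeval (fun l => s^[i] (x l)) p) := by
  induction p using MvPolynomial.induction_on with
  | C c => simp [h.map_algebraMap]
  | add p q hp hq => simp only [map_add, hp, hq]
  | mul_X p l hp =>
    rw [map_mul, map_mul, hp, map_mul, map_mul, MvPolynomial.map_X, MvPolynomial.aeval_X,
      MvPolynomial.aeval_X, Function.iterate_succ_apply']

theorem map_kernelIdeal_le (h : IsSemilinearHopfEnd σ s) (I : Ideal A) (hI : ∀ a ∈ I, s a ∈ I)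
    (i : ℕ) : (kernelIdeal k s x I i).map (MvPolynomial.map σ) ≤ kernelIdeal k s x I (i + 1) := by
  refine Ideal.map_le_iff_le_comap.2 ?_
  rintro p ⟨u, hu, hu', hp⟩
  refine ⟨s u, hI u hu, map_mem_orderSubalgebra h hu', ?_⟩
  rw [aeval_map_iterate h, ← map_sub]
  exact map_mem_augmentation h hp

theorem map_comul_map_eq_zero (h : IsSemilinearHopfEnd σ s) {C D : Type*} [CommRing C] [CommRing D]
    [Algebra k C] [Algebra k D] (p : A →ₐ[k] C) (q : A →ₐ[k] D) (sC : C →+* C) (sD : D →+* D)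
    (hp : ∀ a, p (s a) = sC (p a)) (hq : ∀ a, q (s a) = sD (q a)) {a : A}
    (ha : Algebra.TensorProduct.map p q (comul (R := k) a) = 0) :
    Algebra.TensorProduct.map p q (comul (R := k) (s a)) = 0 := by
  have hC : ∀ c, sC (algebraMap k C c) = algebraMap k C (σ c) := fun c => by
    rw [← p.commutes, ← hp, h.map_algebraMap, p.commutes]
  have hD : ∀ c, sD (algebraMap k D c) = algebraMap k D (σ c) := fun c => by
    rw [← q.commutes, ← hq, h.map_algebraMap, q.commutes]
  rw [h.comul_map, map_tensorMapRingHom s s sC sD _ _ hC hD p q p q hp hq, ha, map_zero]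

/-- A Hopf ideal stable under the endomorphism is generated, as such an ideal, by finitely many
elements. -/
theorem exists_finset_generating_hopfIdeal (h : IsSemilinearHopfEnd σ s)
    (hx : IsHopfSubalgebra (Algebra.adjoin k (Set.range x)))
    (hgen : ∀ S : Subalgebra k A, Set.range x ⊆ S → (∀ b ∈ S, s b ∈ S) → S = ⊤)
    (I : Ideal A) [I.IsHopfIdeal k] (hI : ∀ a ∈ I, s a ∈ I) :
    ∃ F : Finset A, (F : Set A) ⊆ I ∧
      ∀ J : Ideal A, (∀ a ∈ J, s a ∈ J) → (F : Set A) ⊆ J → I ≤ J := by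
  classical
  obtain ⟨n, hn⟩ := exists_forall_ge_eq_map_of_twisted_chain (MonomialOrder.lex (σ := Fin N)) σ
    (kernelIdeal k s x I) (map_kernelIdeal_le h I hI)
  set m := n + 1 with hm
  let S := orderSubalgebra k s x
  have hS : ∀ i, IsHopfSubalgebra (S i) := isHopfSubalgebra_orderSubalgebra h hx
  -- The ideal generated by the part of `I` of order at most `m`.
  let I' : Ideal A := Ideal.span {a | ∃ j, ∃ f ∈ I, f ∈ S m ∧ a = s^[j] f}
  have hI's : ∀ a ∈ I', s a ∈ I' := by
    have : I' ≤ I'.comap s := by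
      refine Ideal.span_le.2 ?_
      rintro _ ⟨j, f, hf, hfm, rfl⟩
      exact Ideal.subset_span ⟨j + 1, f, hf, hfm, (Function.iterate_succ_apply' _ _ _).symm⟩
    exact this
  have hbase : ∀ f ∈ I, f ∈ S m → f ∈ I' := fun f hf hfm =>
    Ideal.subset_span ⟨0, f, hf, hfm, rfl⟩
  -- The part of `I` of order at most `i`: it is stable under translation by points of `A ⧸ I`.
  let U : ℕ → Submodule k A := fun i =>
    I.restrictScalars k ⊓ Subalgebra.toSubmodule (S i)
  have hU : ∀ i, ∀ u ∈ U i, ∀ l : A ⧸ I →ₗ[k] k, tensorSlice A l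
      (Algebra.TensorProduct.map (AlgHom.id k A) (Ideal.Quotient.mkₐ k I)
        (comul (R := k) u)) ∈ U i := by
    rintro i u ⟨huI, huS⟩ l
    have e := tensorSlice_map (LinearMap.id : A →ₗ[k] A) (Ideal.Quotient.mkₐ k I).toLinearMap l
      (comul (R := k) u)
    have e' := tensorSlice_map (Ideal.Quotient.mkₐ k I).toLinearMap
      (Ideal.Quotient.mkₐ k I).toLinearMap l (comul (R := k) u)
    have hz : TensorProduct.map (Ideal.Quotient.mkₐ k I).toLinearMap
        (Ideal.Quotient.mkₐ k I).toLinearMap (comul (R := k) u) =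
        comul (R := k) (Ideal.Quotient.mk I u) := rfl
    rw [hz, Ideal.Quotient.eq_zero_iff_mem.2 huI, map_zero, map_zero] at e'
    refine (congrArg (· ∈ U i) e).mpr ⟨Ideal.Quotient.eq_zero_iff_mem.1 e'.symm, ?_⟩
    exact (hS i).tensorSlice_comul_mem huS _
  -- Hence `I'` is stable under translation as well: the closed subscheme of `I'` is a union of
  -- cosets of the closed subgroup of `I`.
  have hI'Δ : ∀ a ∈ I', Algebra.TensorProduct.map (Ideal.Quotient.mkₐ k I')
      (Ideal.Quotient.mkₐ k I) (comul (R := k) a) = 0 := by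
    let Φ : A →ₐ[k] (A ⧸ I') ⊗[k] (A ⧸ I) := (Algebra.TensorProduct.map (Ideal.Quotient.mkₐ k I')
      (Ideal.Quotient.mkₐ k I)).comp (Bialgebra.comulAlgHom k A)
    have hle : I' ≤ RingHom.ker Φ.toRingHom := by
      refine Ideal.span_le.2 ?_
      rintro _ ⟨j, f, hf, hfm, rfl⟩
      change Φ _ = 0
      induction j with
      | zero =>
        obtain ⟨n', l, b, hz⟩ := exists_eq_sum_tensorSlice_tmul_single
          (Algebra.TensorProduct.map (AlgHom.id k A) (Ideal.Quotient.mkₐ k I) (comul (R := k) f))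
        have e : Φ f = Algebra.TensorProduct.map (Ideal.Quotient.mkₐ k I') (AlgHom.id k (A ⧸ I))
            (Algebra.TensorProduct.map (AlgHom.id k A) (Ideal.Quotient.mkₐ k I)
              (comul (R := k) f)) := by
          change Algebra.TensorProduct.map _ _ (comul (R := k) f) = _
          rw [← AlgHom.comp_apply (Algebra.TensorProduct.map _ _), ← Algebra.TensorProduct.map_comp]
          rfl
        change Φ f = 0
        rw [e, hz, map_sum]
        refine Finset.sum_eq_zero fun t _ => ?_
        have := hU m f ⟨hf, hfm⟩ (l t)
        rw [Algebra.TensorProduct.map_tmul, Ideal.Quotient.mkₐ_eq_mk,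
          Ideal.Quotient.eq_zero_iff_mem.2 (hbase _ this.1 this.2), zero_tmul]
      | succ j ih =>
        rw [Function.iterate_succ_apply']
        exact map_comul_map_eq_zero h _ _ (Ideal.quotientMap I' s hI's) (Ideal.quotientMap I s hI)
          (fun _ => rfl) (fun _ => rfl) ih
    exact hle
  -- Functions in `I` of order `m + i + 1` are, up to functions of order `m + i` vanishing at the
  -- identity, combinations of `s (w)` with `w ∈ I` of order `m + i`. So `I'` and `I` agree in order
  -- `m + i + 1` once this holds modulo the augmentation ideal, and the comparison along the Hopf
  -- subalgebra of order `m + i` removes the augmentation ideal.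
  have hstep : ∀ i, ∀ f ∈ I, f ∈ S (m + i) → f ∈ I' := by
    intro i
    induction i with
    | zero => exact hbase
    | succ i ih =>
      intro f hf hfS
      refine (hS (m + i)).le_of_le_sup_augmentation I I' hI'Δ ih (U (m + i + 1)) (hU _) ?_ f
        ⟨hf, hfS⟩
      rintro u ⟨huI, huS⟩
      obtain ⟨p, hp⟩ := exists_sub_aeval_mem_augmentation (x := x) (s := s) huS
      have hpJ : p ∈ kernelIdeal k s x I (m + i) :=
        ⟨u, huI, huS, by rw [← neg_sub]; exact neg_mem hp⟩
      rw [show m + i = n + i + 1 by omega, hn (n + i) (by omega)] at hpJ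
      have hle : (kernelIdeal k s x I (n + i)).map (MvPolynomial.map σ) ≤
          (I' ⊔ augmentation k s x (m + i)).comap
            (MvPolynomial.aeval (R := k) (fun l => s^[m + i + 1] (x l))).toRingHom := by
        refine Ideal.map_le_iff_le_comap.2 ?_
        rintro q ⟨w, hw, hwS, hq⟩
        change MvPolynomial.aeval (fun l => s^[m + i + 1] (x l)) (MvPolynomial.map σ q) ∈
          I' ⊔ augmentation k s x (m + i)
        rw [aeval_map_iterate h, ← sub_add_cancel (MvPolynomial.aeval _ q) w, map_add]
        rw [show n + i + 1 = m + i by omega] at hq hwS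
        refine add_mem (Ideal.mem_sup_right ?_) (Ideal.mem_sup_left (hI's _ (ih w hw hwS)))
        have := map_mem_augmentation h hq
        rwa [show n + i + 1 = m + i by omega] at this
      have hp' := hle hpJ
      rw [← sub_add_cancel u (MvPolynomial.aeval (fun l => s^[m + i + 1] (x l)) p)]
      exact add_mem (Ideal.mem_sup_right hp) hp'
  have hII' : I ≤ I' := by
    intro f hf
    obtain ⟨i, hi⟩ := exists_mem_orderSubalgebra h hgen f
    exact hstep i f hf (orderSubalgebra_mono (by omega) hi)
  have : Algebra.FiniteType k (S m) := (Subalgebra.fg_iff_finiteType _).1 (fg_orderSubalgebra m)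
  have : IsNoetherianRing (S m) := Algebra.FiniteType.isNoetherianRing k _
  obtain ⟨F, hF⟩ := IsNoetherian.noetherian (I.comap (S m).val.toRingHom)
  have hFI : ∀ f ∈ F, (f : A) ∈ I := fun f hf =>
    (hF ▸ Submodule.subset_span hf : f ∈ I.comap (S m).val.toRingHom)
  refine ⟨F.image (S m).val, ?_, fun J hJ hFJ => hII'.trans (Ideal.span_le.2 ?_)⟩
  · intro a ha
    obtain ⟨f, hf, rfl⟩ := Finset.mem_image.1 (Finset.mem_coe.1 ha)
    exact hFI f hf
  · rintro _ ⟨j, f, hf, hfm, rfl⟩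
    have hfJ : f ∈ J := by
      have hle : I.comap (S m).val.toRingHom ≤ J.comap (S m).val.toRingHom := by
        rw [← hF]
        refine Submodule.span_le.2 fun g hg => ?_
        exact hFJ (Finset.mem_coe.2 (Finset.mem_image_of_mem _ hg))
      exact hle (show (⟨f, hfm⟩ : S m) ∈ I.comap (S m).val.toRingHom from hf)
    induction j with
    | zero => exact hfJ
    | succ j ih =>
      rw [SetLike.mem_coe, Function.iterate_succ_apply']
      exact hJ _ ih

end

end FiniteGeneration

/-! ### Constructions of difference algebras -/

namespace SigmaAlg

section Constructions

variable {k : Type u} [CommRing k] {σ : k →+* k}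

/-- A morphism of `k`-`σ`-algebras from an algebra morphism commuting with `σ`. -/
def ofAlgHom {A B : SigmaAlg k σ} (f : A →ₐ[k] B) (h : ∀ a : A, f (A.sig a) = B.sig (f a)) :
    A ⟶ B :=
  Hom.mk f h

@[simp]
theorem algHom_ofAlgHom {A B : SigmaAlg k σ} (f : A →ₐ[k] B)
    (h : ∀ a : A, f (A.sig a) = B.sig (f a)) : algHom (ofAlgHom f h) = f := rfl

theorem hom_ext {A B : SigmaAlg k σ} {f g : A ⟶ B} (h : algHom f = algHom g) : f = g :=
  Hom.ext h

theorem algHom_sig {A B : SigmaAlg k σ} (f : A ⟶ B) (a : A) :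
    algHom f (A.sig a) = B.sig (algHom f a) :=
  Hom.map_sig f a

/-- The base ring as a difference algebra over itself. -/
abbrev base (k : Type u) [CommRing k] (σ : k →+* k) : SigmaAlg k σ where
  carrier := k
  sig := σ
  sig_algebraMap _ := rfl

/-- The structure morphism of a difference algebra. -/
def ofBase (R : SigmaAlg k σ) : base k σ ⟶ R :=
  ofAlgHom (A := base k σ) (Algebra.ofId k R) fun a => (R.sig_algebraMap a).symm

/-- The tensor product of difference algebras, with the endomorphism `σ ⊗ σ`. -/
noncomputable abbrev tensor (A B : SigmaAlg k σ) : SigmaAlg k σ where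
  carrier := A ⊗[k] B
  sig := tensorMapRingHom A.sig B.sig A.sig_algebraMap B.sig_algebraMap
  sig_algebraMap a := by
    rw [Algebra.TensorProduct.algebraMap_apply, tensorMapRingHom_tmul, A.sig_algebraMap, map_one,
      Algebra.TensorProduct.algebraMap_apply]

@[simp]
theorem tensor_sig_tmul (A B : SigmaAlg k σ) (a : A) (b : B) :
    (tensor A B).sig (a ⊗ₜ[k] b) = A.sig a ⊗ₜ[k] B.sig b :=
  tensorMapRingHom_tmul _ _ A.sig_algebraMap B.sig_algebraMap a b

/-- The first inclusion into a tensor product of difference algebras. -/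
noncomputable def inl (A B : SigmaAlg k σ) : A ⟶ tensor A B :=
  ofAlgHom (B := tensor A B) Algebra.TensorProduct.includeLeft fun a => by
    rw [Algebra.TensorProduct.includeLeft_apply, Algebra.TensorProduct.includeLeft_apply]
    exact ((tensor_sig_tmul A B a 1).trans (by rw [map_one])).symm

/-- The second inclusion into a tensor product of difference algebras. -/
noncomputable def inr (A B : SigmaAlg k σ) : B ⟶ tensor A B :=
  ofAlgHom (B := tensor A B) Algebra.TensorProduct.includeRight fun a => by
    rw [Algebra.TensorProduct.includeRight_apply, Algebra.TensorProduct.includeRight_apply]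
    exact ((tensor_sig_tmul A B 1 a).trans (by rw [map_one])).symm

/-- The morphism out of a tensor product of difference algebras given by two morphisms. -/
noncomputable def tensorLift {A B R : SigmaAlg k σ} (f : A ⟶ R) (g : B ⟶ R) : tensor A B ⟶ R :=
  ofAlgHom (A := tensor A B)
    (Algebra.TensorProduct.lift (algHom f) (algHom g) fun _ _ => Commute.all _ _) fun z => by
    change A ⊗[k] B at z
    induction z using TensorProduct.induction_on with
    | zero => exact (congrArg _ (map_zero _)).trans ((map_zero _).trans (by simp))
    | tmul a b =>
      refine (congrArg _ (tensor_sig_tmul A B a b)).trans ?_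
      simp [algHom_sig]
    | add a b ha hb =>
      refine (congrArg _ (map_add (tensor A B).sig a b)).trans ((map_add _ _ _).trans ?_)
      rw [ha, hb, ← map_add R.sig]
      exact congrArg R.sig (map_add _ _ _).symm

@[simp]
theorem inl_tensorLift {A B R : SigmaAlg k σ} (f : A ⟶ R) (g : B ⟶ R) :
    inl A B ≫ tensorLift f g = f :=
  hom_ext (Algebra.TensorProduct.lift_comp_includeLeft _ _ fun _ _ => Commute.all _ _)

@[simp]
theorem inr_tensorLift {A B R : SigmaAlg k σ} (f : A ⟶ R) (g : B ⟶ R) :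
    inr A B ≫ tensorLift f g = g :=
  hom_ext (Algebra.TensorProduct.lift_comp_includeRight _ _ fun _ _ => Commute.all _ _)

theorem algHom_tensorLift_comp_inl_inr {A B : SigmaAlg k σ} (p : A ⟶ B) (z : A ⊗[k] A) :
    algHom (tensorLift (p ≫ inl B B) (p ≫ inr B B)) z =
      Algebra.TensorProduct.map (algHom p) (algHom p) z := by
  induction z with
  | zero => rw [map_zero]; exact map_zero (algHom (tensorLift (p ≫ inl B B) (p ≫ inr B B)))
  | tmul a b =>
    refine (Algebra.TensorProduct.tmul_mul_tmul (algHom p a) (1 : B) (1 : B) (algHom p b)).trans ?_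
    rw [mul_one, one_mul]
    rfl
  | add a b ha hb =>
    exact (map_add (algHom (tensorLift (p ≫ inl B B) (p ≫ inr B B))) a b).trans
      (by rw [map_add, ha, hb])

/-- The quotient of a difference algebra by an ideal stable under the endomorphism. -/
abbrev quotient (A : SigmaAlg k σ) (I : Ideal A) (hI : A.IsSigmaIdeal I) : SigmaAlg k σ where
  carrier := A ⧸ I
  sig := Ideal.quotientMap I A.sig hI
  sig_algebraMap a := congrArg (Ideal.Quotient.mk I) (A.sig_algebraMap a)

/-- The projection to a quotient of a difference algebra. -/
def mkQuotient (A : SigmaAlg k σ) (I : Ideal A) (hI : A.IsSigmaIdeal I) : A ⟶ quotient A I hI :=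
  ofAlgHom (B := quotient A I hI) (Ideal.Quotient.mkₐ k I) fun _ => rfl

end Constructions

end SigmaAlg

/-! ### The Hopf algebra of a difference algebraic group -/

section GroupFunctor

open SigmaAlg

variable {k : Type u} [Field k] {σ : k →+* k} {G : SigmaAlg k σ ⥤ GrpCat.{u}}
  {A : SigmaAlg k σ} (e : (G ⋙ forget GrpCat.{u}).CorepresentableBy A)

/-- The element of `G R` corresponding to a morphism from the coordinate ring to `R`. -/
def groupPoint {R : SigmaAlg k σ} (ψ : A ⟶ R) : G.obj R := e.homEquiv ψ

/-- The morphism from the coordinate ring to `R` corresponding to an element of `G R`. -/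
def coordHom {R : SigmaAlg k σ} (g : G.obj R) : A ⟶ R := e.homEquiv.symm g

@[simp]
theorem groupPoint_coordHom {R : SigmaAlg k σ} (g : G.obj R) :
    groupPoint e (coordHom e g) = g :=
  e.homEquiv.apply_symm_apply g

@[simp]
theorem coordHom_groupPoint {R : SigmaAlg k σ} (ψ : A ⟶ R) :
    coordHom e (groupPoint e ψ) = ψ :=
  e.homEquiv.symm_apply_apply ψ

theorem groupPoint_injective {R : SigmaAlg k σ} :
    Function.Injective (groupPoint e : (A ⟶ R) → G.obj R) :=
  e.homEquiv.injective

theorem groupPoint_comp {R S : SigmaAlg k σ} (ψ : A ⟶ R) (f : R ⟶ S) :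
    groupPoint e (ψ ≫ f) = (G.map f).hom (groupPoint e ψ) :=
  e.homEquiv_comp f ψ

/-- The comultiplication: the product of the two projections. -/
noncomputable def comulHom : A ⟶ tensor A A :=
  coordHom e (groupPoint e (inl A A) * groupPoint e (inr A A))

/-- The counit: the identity element. -/
noncomputable def counitHom : A ⟶ base k σ := coordHom e 1

/-- The antipode: the inverse of the universal element. -/
noncomputable def antipodeHom : A ⟶ A := coordHom e (groupPoint e (𝟙 A))⁻¹

theorem groupPoint_mul {R : SigmaAlg k σ} (f g : A ⟶ R) :
    groupPoint e f * groupPoint e g = groupPoint e (comulHom e ≫ tensorLift f g) := by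
  rw [groupPoint_comp, comulHom, groupPoint_coordHom, map_mul, ← groupPoint_comp,
    ← groupPoint_comp, inl_tensorLift, inr_tensorLift]

theorem groupPoint_one (R : SigmaAlg k σ) :
    (1 : G.obj R) = groupPoint e (counitHom e ≫ ofBase R) := by
  rw [groupPoint_comp, counitHom, groupPoint_coordHom, map_one]

theorem groupPoint_inv {R : SigmaAlg k σ} (f : A ⟶ R) :
    (groupPoint e f)⁻¹ = groupPoint e (antipodeHom e ≫ f) := by
  rw [groupPoint_comp, antipodeHom, groupPoint_coordHom, map_inv, ← groupPoint_comp,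
    Category.id_comp]

/-- The Hopf algebra structure on the coordinate ring of a group functor. -/
noncomputable abbrev hopfAlgebraOfGroup : HopfAlgebra k A :=
  letI : Bialgebra k A := Bialgebra.ofAlgHom (algHom (comulHom e)) (algHom (counitHom e))
    (by
      let T := tensor A (tensor A A)
      let j1 : A ⟶ T := inl A (tensor A A)
      let j2 : A ⟶ T := inl A A ≫ inr A (tensor A A)
      let j3 : A ⟶ T := inr A A ≫ inr A (tensor A A)
      have h : comulHom e ≫ tensorLift (comulHom e ≫ tensorLift j1 j2) j3 =
          comulHom e ≫ tensorLift j1 (comulHom e ≫ tensorLift j2 j3) := by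
        apply groupPoint_injective e
        simp only [← groupPoint_mul, mul_assoc]
      have h1 : ∀ z : A ⊗[k] A, Algebra.TensorProduct.assoc k k k A A A (z ⊗ₜ[k] (1 : A)) =
          algHom (tensorLift j1 j2) z := by
        intro z
        induction z with
        | zero => simp
        | tmul a b =>
          exact ((Algebra.TensorProduct.tmul_mul_tmul a 1 1 (b ⊗ₜ[k] (1 : A))).trans
            (by rw [mul_one, one_mul]; rfl)).symm
        | add a b ha hb =>
          rw [add_tmul, map_add, ha, hb]
          exact (map_add (algHom (tensorLift j1 j2)) a b).symm
      have h2 : ∀ z : A ⊗[k] A, (1 : A) ⊗ₜ[k] z = algHom (tensorLift j2 j3) z := by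
        intro z
        induction z with
        | zero => simp
        | tmul a b =>
          refine Eq.trans ?_ (Algebra.TensorProduct.tmul_mul_tmul (1 : A) 1 (a ⊗ₜ[k] (1 : A))
            ((1 : A) ⊗ₜ[k] b)).symm
          rw [Algebra.TensorProduct.tmul_mul_tmul, mul_one, one_mul, mul_one]
        | add a b ha hb =>
          rw [tmul_add, ha, hb]
          exact (map_add (algHom (tensorLift j2 j3)) a b).symm
      have h3 : (Algebra.TensorProduct.assoc k k k A A A).toAlgHom.comp
          (Algebra.TensorProduct.map (algHom (comulHom e)) (.id k A)) =
          algHom (tensorLift (comulHom e ≫ tensorLift j1 j2) j3) := by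
        apply Algebra.TensorProduct.ext'
        intro a b
        have e1 : algHom (comulHom e) a ⊗ₜ[k] b =
            (algHom (comulHom e) a ⊗ₜ[k] (1 : A)) * ((1 : A ⊗[k] A) ⊗ₜ[k] b) := by
          rw [Algebra.TensorProduct.tmul_mul_tmul, mul_one, one_mul]
        change Algebra.TensorProduct.assoc k k k A A A (algHom (comulHom e) a ⊗ₜ[k] b) = _
        rw [e1, map_mul, h1]
        rfl
      have h4 : Algebra.TensorProduct.map (.id k A) (algHom (comulHom e)) =
          algHom (tensorLift j1 (comulHom e ≫ tensorLift j2 j3)) := by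
        apply Algebra.TensorProduct.ext'
        intro a b
        have e1 : a ⊗ₜ[k] algHom (comulHom e) b =
            (a ⊗ₜ[k] (1 : A ⊗[k] A)) * ((1 : A) ⊗ₜ[k] algHom (comulHom e) b) := by
          rw [Algebra.TensorProduct.tmul_mul_tmul, mul_one, one_mul]
        change a ⊗ₜ[k] algHom (comulHom e) b = _
        rw [e1, h2]
        rfl
      rw [← AlgHom.comp_assoc, h3, h4]
      exact congrArg algHom h)
    (by
      have h : comulHom e ≫ tensorLift (counitHom e ≫ ofBase A) (𝟙 A) = 𝟙 A := by
        apply groupPoint_injective e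
        rw [← groupPoint_mul, ← groupPoint_one, one_mul]
      have h1 : (Algebra.TensorProduct.lid k A).toAlgHom.comp
          (Algebra.TensorProduct.map (algHom (counitHom e)) (.id k A)) =
          algHom (tensorLift (counitHom e ≫ ofBase A) (𝟙 A)) := by
        apply Algebra.TensorProduct.ext'
        intro a b
        exact Algebra.smul_def _ _
      refine AlgHom.ext fun a => (Algebra.TensorProduct.lid k A).injective ?_
      refine (DFunLike.congr_fun h1 (algHom (comulHom e) a)).trans ?_
      refine (DFunLike.congr_fun (congrArg algHom h) a).trans ?_
      simp)
    (by
      have h : comulHom e ≫ tensorLift (𝟙 A) (counitHom e ≫ ofBase A) = 𝟙 A := by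
        apply groupPoint_injective e
        rw [← groupPoint_mul, ← groupPoint_one, mul_one]
      have h1 : (Algebra.TensorProduct.rid k k A).toAlgHom.comp
          (Algebra.TensorProduct.map (.id k A) (algHom (counitHom e))) =
          algHom (tensorLift (𝟙 A) (counitHom e ≫ ofBase A)) := by
        apply Algebra.TensorProduct.ext'
        intro a b
        exact (Algebra.smul_def _ _).trans (mul_comm _ _)
      refine AlgHom.ext fun a => (Algebra.TensorProduct.rid k k A).injective ?_
      refine (DFunLike.congr_fun h1 (algHom (comulHom e) a)).trans ?_
      refine (DFunLike.congr_fun (congrArg algHom h) a).trans ?_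
      simp)
  HopfAlgebra.ofAlgHom (algHom (antipodeHom e))
    (by
      have h : comulHom e ≫ tensorLift (antipodeHom e) (𝟙 A) = counitHom e ≫ ofBase A := by
        apply groupPoint_injective e
        rw [← groupPoint_mul, ← groupPoint_one, ← Category.comp_id (antipodeHom e),
          ← groupPoint_inv, inv_mul_cancel]
      exact congrArg algHom h)
    (by
      have h : comulHom e ≫ tensorLift (𝟙 A) (antipodeHom e) = counitHom e ≫ ofBase A := by
        apply groupPoint_injective e
        rw [← groupPoint_mul, ← groupPoint_one, ← Category.comp_id (antipodeHom e),
          ← groupPoint_inv, mul_inv_cancel]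
      exact congrArg algHom h)

theorem isSemilinearHopfEnd_sig :
    letI := hopfAlgebraOfGroup e
    IsSemilinearHopfEnd σ A.sig :=
  letI := hopfAlgebraOfGroup e
  { map_algebraMap := A.sig_algebraMap
    comul_map := algHom_sig (comulHom e)
    counit_map := algHom_sig (counitHom e)
    antipode_map := algHom_sig (antipodeHom e) }

/-- The ideal of a closed subgroup is a Hopf ideal. -/
theorem isHopfIdeal_of_closedSubgroup (H : SigmaClosedSubgroup G) (I : Ideal A)
    (hI : A.IsSigmaIdeal I) (hH : ∀ (R : SigmaAlg k σ) (ψ : A ⟶ R),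
      groupPoint e ψ ∈ H.points R ↔ ∀ f ∈ I, algHom ψ f = 0) :
    letI := hopfAlgebraOfGroup e
    I.IsHopfIdeal k := by
  let _ := hopfAlgebraOfGroup e
  let B := quotient A I hI
  let p : A ⟶ B := mkQuotient A I hI
  have hp : ∀ f ∈ I, algHom p f = 0 := fun f hf => Ideal.Quotient.eq_zero_iff_mem.2 hf
  have hmem : ∀ {R : SigmaAlg k σ} (q : B ⟶ R), groupPoint e (p ≫ q) ∈ H.points R := by
    intro R q
    refine (hH R _).2 fun f hf => ?_
    rw [algHom_comp, AlgHom.comp_apply, hp f hf, map_zero]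
  refine { counit_eq_zero := ?_, map_mkQ_comul_eq_zero := ?_, antipode_mem := ?_ }
  · refine (hH _ (counitHom e)).1 ?_
    rw [counitHom, groupPoint_coordHom]
    exact one_mem _
  · have h := mul_mem (hmem (inl B B)) (hmem (inr B B))
    rw [groupPoint_mul, hH] at h
    intro x hx
    exact (algHom_tensorLift_comp_inl_inr p _).symm.trans (h x hx)
  · have h := inv_mem (hmem (𝟙 B))
    rw [groupPoint_inv, hH] at h
    intro x hx
    exact Ideal.Quotient.eq_zero_iff_mem.1 (h x hx)

end GroupFunctor

/-! ### Difference polynomials and the coordinate ring of the general linear group -/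

namespace SigmaAlg

section Free

variable {k : Type u} [CommRing k] (σ : k →+* k) (ι : Type)

/-- The difference polynomial ring in the variables `ι`: the variable `(i, n)` stands for
`σ^n(x_i)`. -/
noncomputable abbrev polynomial : SigmaAlg k σ where
  carrier := MvPolynomial (ι × ℕ) k
  sig := MvPolynomial.eval₂Hom (MvPolynomial.C.comp σ) fun p => MvPolynomial.X (p.1, p.2 + 1)
  sig_algebraMap a := by simp [MvPolynomial.algebraMap_eq]

variable {σ ι}

theorem polynomial_sig_X (p : ι × ℕ) :
    (polynomial σ ι).sig (MvPolynomial.X p) = MvPolynomial.X (p.1, p.2 + 1) := by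
  simp

theorem iterate_map_algHom {A B : SigmaAlg k σ} (f : A ⟶ B) (n : ℕ) (a : A) :
    algHom f (A.sig^[n] a) = B.sig^[n] (algHom f a) := by
  induction n with
  | zero => rfl
  | succ n ih => rw [Function.iterate_succ_apply', algHom_sig, ih, Function.iterate_succ_apply']

/-- The morphism out of a difference polynomial ring with given values on the variables. -/
noncomputable def polynomialLift {R : SigmaAlg k σ} (x : ι → R) : polynomial σ ι ⟶ R :=
  ofAlgHom (A := polynomial σ ι) (MvPolynomial.aeval fun p => R.sig^[p.2] (x p.1)) fun f => by
    induction f using MvPolynomial.induction_on with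
    | C c => simp [R.sig_algebraMap]
    | add p q hp hq => rw [map_add, map_add, map_add, map_add, hp, hq]
    | mul_X p l hp =>
      rw [map_mul, map_mul, map_mul, map_mul, hp, polynomial_sig_X, MvPolynomial.aeval_X,
        MvPolynomial.aeval_X, Function.iterate_succ_apply']

theorem polynomialLift_X {R : SigmaAlg k σ} (x : ι → R) (i : ι) :
    algHom (polynomialLift x) (MvPolynomial.X (i, 0) : MvPolynomial (ι × ℕ) k) = x i := by
  simp [polynomialLift]

theorem polynomial_X_eq_iterate (i : ι) (n : ℕ) :
    (MvPolynomial.X (i, n) : MvPolynomial (ι × ℕ) k) =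
      (polynomial σ ι).sig^[n] (MvPolynomial.X (i, 0) : MvPolynomial (ι × ℕ) k) := by
  induction n with
  | zero => rfl
  | succ n ih => rw [Function.iterate_succ_apply', ← ih, polynomial_sig_X]

theorem polynomial_hom_ext {R : SigmaAlg k σ} {f g : polynomial σ ι ⟶ R}
    (h : ∀ i, algHom f (MvPolynomial.X (i, 0) : MvPolynomial (ι × ℕ) k) =
      algHom g (MvPolynomial.X (i, 0) : MvPolynomial (ι × ℕ) k)) : f = g := by
  refine hom_ext (MvPolynomial.algHom_ext ?_)
  rintro ⟨i, n⟩
  rw [polynomial_X_eq_iterate (σ := σ)]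
  exact (iterate_map_algHom f n _).trans ((congrArg _ (h i)).trans (iterate_map_algHom g n _).symm)

/-- The morphism out of a quotient induced by a morphism vanishing on the ideal. -/
def quotientLift {A R : SigmaAlg k σ} {I : Ideal A} (hI : A.IsSigmaIdeal I) (f : A ⟶ R)
    (hf : ∀ a ∈ I, algHom f a = 0) : quotient A I hI ⟶ R :=
  ofAlgHom (A := quotient A I hI) (Ideal.Quotient.liftₐ I (algHom f) hf) fun a => by
    obtain ⟨a, rfl⟩ := Ideal.Quotient.mk_surjective a
    exact algHom_sig f a

@[simp]
theorem mkQuotient_quotientLift {A R : SigmaAlg k σ} {I : Ideal A} (hI : A.IsSigmaIdeal I)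
    (f : A ⟶ R) (hf : ∀ a ∈ I, algHom f a = 0) : mkQuotient A I hI ≫ quotientLift hI f hf = f :=
  hom_ext (AlgHom.ext fun _ => rfl)

theorem quotient_hom_ext {A R : SigmaAlg k σ} {I : Ideal A} {hI : A.IsSigmaIdeal I}
    {f g : quotient A I hI ⟶ R} (h : mkQuotient A I hI ≫ f = mkQuotient A I hI ≫ g) : f = g := by
  refine hom_ext (AlgHom.ext fun a => ?_)
  obtain ⟨a, rfl⟩ := Ideal.Quotient.mk_surjective a
  exact DFunLike.congr_fun (congrArg algHom h) a

theorem finitelySigmaGenerated_quotient_polynomial [Finite ι] (I : Ideal (MvPolynomial (ι × ℕ) k))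
    (hI : (polynomial σ ι).IsSigmaIdeal I) :
    (quotient (polynomial σ ι) I hI).FinitelySigmaGenerated := by
  classical
  cases nonempty_fintype ι
  let q := mkQuotient (polynomial σ ι) I hI
  refine ⟨Finset.univ.image fun i : ι =>
    algHom q (MvPolynomial.X (i, 0) : MvPolynomial (ι × ℕ) k), fun B hB hBs => ?_⟩
  have hX : ∀ p : ι × ℕ, algHom q (MvPolynomial.X p : MvPolynomial (ι × ℕ) k) ∈ B := by
    rintro ⟨i, n⟩
    rw [polynomial_X_eq_iterate (σ := σ)]
    refine (congrArg (· ∈ B) (iterate_map_algHom q n _)).mpr ?_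
    induction n with
    | zero => exact hB (Finset.mem_coe.2 (Finset.mem_image_of_mem _ (Finset.mem_univ i)))
    | succ n ih =>
      rw [Function.iterate_succ_apply']
      exact hBs _ ih
  rw [eq_top_iff]
  rintro a -
  obtain ⟨f, rfl⟩ := Ideal.Quotient.mk_surjective a
  change algHom q f ∈ B
  induction f using MvPolynomial.induction_on with
  | C c => exact (congrArg (· ∈ B) ((algHom q).commutes c)).mpr (B.algebraMap_mem c)
  | add f g hf hg => rw [map_add]; exact add_mem hf hg
  | mul_X f p hf => rw [map_mul]; exact mul_mem hf (hX p)

end Free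

section GLCoord

variable {k : Type u} [CommRing k] (σ : k →+* k) (κ : Type) [Fintype κ] [DecidableEq κ]

/-- The matrix of variables, or the matrix of the variables for the inverse. -/
noncomputable def varMatrix (k : Type u) [CommRing k] (κ : Type) (b : Bool) :
    Matrix κ κ (MvPolynomial ((Bool × κ × κ) × ℕ) k) :=
  Matrix.of fun i j => MvPolynomial.X ((b, i, j), 0)

/-- The ideal of relations saying that the two matrices of variables are inverse to each other. -/
noncomputable def glIdeal : Ideal (MvPolynomial ((Bool × κ × κ) × ℕ) k) :=
  Ideal.span {a | ∃ (n : ℕ) (i j : κ), a = (polynomial σ (Bool × κ × κ)).sig^[n]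
    ((varMatrix k κ true * varMatrix k κ false - 1) i j)}

theorem isSigmaIdeal_glIdeal : (polynomial σ (Bool × κ × κ)).IsSigmaIdeal (glIdeal σ κ) := by
  have : glIdeal σ κ ≤ (glIdeal σ κ).comap (polynomial σ (Bool × κ × κ)).sig := by
    refine Ideal.span_le.2 ?_
    rintro _ ⟨n, i, j, rfl⟩
    exact Ideal.subset_span ⟨n + 1, i, j, (Function.iterate_succ_apply' _ _ _).symm⟩
  exact this

/-- The coordinate ring of the general linear group. -/
noncomputable abbrev glCoord : SigmaAlg k σ :=
  quotient (polynomial σ (Bool × κ × κ)) (glIdeal σ κ) (isSigmaIdeal_glIdeal σ κ)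

/-- The projection from the difference polynomial ring. -/
noncomputable abbrev glProj : polynomial σ (Bool × κ × κ) ⟶ glCoord σ κ :=
  mkQuotient _ _ (isSigmaIdeal_glIdeal σ κ)

theorem glProj_mul : (varMatrix k κ true).map (algHom (glProj σ κ)) *
    (varMatrix k κ false).map (algHom (glProj σ κ)) = 1 := by
  rw [← Matrix.map_mul, ← sub_eq_zero, ← Matrix.map_one _ (map_zero (algHom (glProj σ κ)))
    (map_one _), ← Matrix.map_sub _ (map_sub _)]
  ext i j
  exact Ideal.Quotient.eq_zero_iff_mem.2 (Ideal.subset_span ⟨0, i, j, rfl⟩)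

/-- The universal invertible matrix. -/
noncomputable def glUniv : (Matrix κ κ (glCoord σ κ))ˣ where
  val := (varMatrix k κ true).map (algHom (glProj σ κ))
  inv := (varMatrix k κ false).map (algHom (glProj σ κ))
  val_inv := glProj_mul σ κ
  inv_val := mul_eq_one_comm.1 (glProj_mul σ κ)

variable {σ κ}

/-- The entries of an invertible matrix and of its inverse. -/
def unitEntry {R : Type*} [CommRing R] (U : (Matrix κ κ R)ˣ) : Bool × κ × κ → R
  | (true, i, j) => U.val i j
  | (false, i, j) => U.inv i j

theorem polynomialLift_unitEntry_eq_zero {R : SigmaAlg k σ} (U : (Matrix κ κ R)ˣ) :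
    ∀ a ∈ glIdeal σ κ, algHom (polynomialLift (unitEntry U)) a = 0 := by
  have h : glIdeal σ κ ≤ RingHom.ker (algHom (polynomialLift (unitEntry U))).toRingHom := by
    refine Ideal.span_le.2 ?_
    rintro _ ⟨n, i, j, rfl⟩
    refine (iterate_map_algHom _ n _).trans ?_
    suffices h0 : algHom (polynomialLift (unitEntry U))
        ((varMatrix k κ true * varMatrix k κ false - 1) i j) = 0 by
      rw [h0, ← RingHom.coe_pow, map_zero]
    have h1 := congrFun (congrFun U.val_inv i) j
    rw [Matrix.mul_apply] at h1
    rw [Matrix.sub_apply, map_sub, Matrix.mul_apply, map_sum, sub_eq_zero]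
    refine (Finset.sum_congr rfl fun l _ => (map_mul _ _ _).trans (congrArg₂ (· * ·)
      (polynomialLift_X _ (true, i, l)) (polynomialLift_X _ (false, l, j)))).trans ?_
    refine h1.trans ?_
    rw [Matrix.one_apply, Matrix.one_apply, apply_ite (algHom _), map_one, map_zero]
  exact h

/-- The morphism out of the coordinate ring of the general linear group given by an invertible
matrix. -/
noncomputable def glLift {R : SigmaAlg k σ} (U : (Matrix κ κ R)ˣ) : glCoord σ κ ⟶ R :=
  quotientLift (isSigmaIdeal_glIdeal σ κ) (polynomialLift (unitEntry U))
    (polynomialLift_unitEntry_eq_zero U)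

theorem glProj_glLift {R : SigmaAlg k σ} (U : (Matrix κ κ R)ˣ) :
    glProj σ κ ≫ glLift U = polynomialLift (unitEntry U) :=
  mkQuotient_quotientLift _ _ _

variable (σ κ)

/-- The coordinate ring of the general linear group corepresents invertible matrices. -/
noncomputable def glHomEquiv (R : SigmaAlg k σ) :
    (glCoord σ κ ⟶ R) ≃ (Matrix κ κ R)ˣ where
  toFun ψ := Units.map ((algHom ψ).mapMatrix (m := κ)).toMonoidHom (glUniv σ κ)
  invFun := glLift
  left_inv ψ := by
    refine quotient_hom_ext ((glProj_glLift _).trans (polynomial_hom_ext ?_))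
    rintro ⟨b, i, j⟩
    refine (polynomialLift_X _ _).trans ?_
    cases b <;> rfl
  right_inv U := by
    refine Units.ext (Matrix.ext fun i j => ?_)
    exact polynomialLift_X (unitEntry U) (true, i, j)

theorem glHomEquiv_comp {R S : SigmaAlg k σ} (ψ : glCoord σ κ ⟶ R) (f : R ⟶ S) :
    glHomEquiv σ κ S (ψ ≫ f) =
      Units.map ((algHom f).mapMatrix (m := κ)).toMonoidHom (glHomEquiv σ κ R ψ) :=
  Units.ext (Matrix.ext fun _ _ => rfl)

end GLCoord

end SigmaAlg

/-! ### Representations given by matrices -/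

section MatrixRep

open SigmaAlg

variable {k : Type u} [Field k] {σ : k →+* k} {κ : Type} [Fintype κ]

/-- The standard basis of `R ⊗ k^κ`. -/
noncomputable def tensorBasis (κ : Type) [Fintype κ] (R : SigmaAlg k σ) :
    Module.Basis κ R (R ⊗[k] (κ → k)) :=
  Algebra.TensorProduct.basis R (Pi.basisFun k κ)

theorem tensorBasis_apply (R : SigmaAlg k σ) (i : κ) :
    tensorBasis κ R i = 1 ⊗ₜ[k] Pi.basisFun k κ i :=
  Algebra.TensorProduct.basis_apply _ _

theorem tensorBasis_repr_tmul (R : SigmaAlg k σ) (a : R) (w : κ → k) (i : κ) :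
    (tensorBasis κ R).repr (a ⊗ₜ[k] w) i = a * algebraMap k R (w i) := by
  rw [tensorBasis, Algebra.TensorProduct.basis_repr_tmul]
  simp

theorem tensorBasis_repr_rTensor {R S : SigmaAlg k σ} (f : R ⟶ S) (z : R ⊗[k] (κ → k)) (i : κ) :
    (tensorBasis κ S).repr ((algHom f).toLinearMap.rTensor (κ → k) z) i =
      algHom f ((tensorBasis κ R).repr z i) := by
  induction z with
  | zero => simp
  | tmul a w =>
    rw [LinearMap.rTensor_tmul, tensorBasis_repr_tmul, tensorBasis_repr_tmul, map_mul,
      AlgHom.commutes]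
    rfl
  | add a b ha hb => simp only [map_add, Finsupp.add_apply, ha, hb]

variable [DecidableEq κ]

/-- Automorphisms of `R ⊗ k^κ` as invertible matrices. -/
noncomputable def glMatrixEquiv (R : SigmaAlg k σ) :
    LinearMap.GeneralLinearGroup R (R ⊗[k] (κ → k)) ≃* (Matrix κ κ R)ˣ :=
  Units.mapEquiv (LinearMap.toMatrixAlgEquiv (tensorBasis κ R)).toMulEquiv

theorem glMatrixEquiv_map {R S : SigmaAlg k σ} (f : R ⟶ S)
    (g : LinearMap.GeneralLinearGroup R (R ⊗[k] (κ → k))) :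
    glMatrixEquiv S (((sigmaGL (σ := σ) (κ → k)).map f).hom g) =
      Units.map ((algHom f).mapMatrix (m := κ)).toMonoidHom (glMatrixEquiv R g) := by
  refine Units.ext (Matrix.ext fun i j => ?_)
  change LinearMap.toMatrix (tensorBasis κ S) (tensorBasis κ S)
    (endBaseChangeFun (κ → k) f g.val) i j =
      algHom f (LinearMap.toMatrix (tensorBasis κ R) (tensorBasis κ R) g.val i j)
  have h : tensorBasis κ S j = (algHom f).toLinearMap.rTensor (κ → k) (tensorBasis κ R j) := by
    rw [tensorBasis_apply, tensorBasis_apply, LinearMap.rTensor_tmul]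
    exact congrArg (· ⊗ₜ[k] _) (map_one (algHom f)).symm
  rw [LinearMap.toMatrix_apply, LinearMap.toMatrix_apply, h, endBaseChangeFun_rTensor,
    tensorBasis_repr_rTensor]

/-- The functor `GL(k^κ)` is corepresented by the coordinate ring of invertible matrices. -/
noncomputable def sigmaGLCorepresentableBy (σ : k →+* k) (κ : Type) [Fintype κ] [DecidableEq κ] :
    (sigmaGL (σ := σ) (κ → k) ⋙ forget GrpCat.{u}).CorepresentableBy (glCoord σ κ) where
  homEquiv {R} := (glHomEquiv σ κ R).trans (glMatrixEquiv R).symm.toEquiv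
  homEquiv_comp {R S} f ψ := by
    apply (glMatrixEquiv S).injective
    refine ((glMatrixEquiv S).apply_symm_apply _).trans ?_
    refine (glHomEquiv_comp σ κ ψ f).trans ?_
    refine Eq.trans ?_ (glMatrixEquiv_map f ((glMatrixEquiv R).symm (glHomEquiv σ κ R ψ))).symm
    rw [MulEquiv.apply_symm_apply]

variable {G : SigmaAlg k σ ⥤ GrpCat.{u}}

/-- The representation on `k^κ` given by a natural family of multiplicative maps to matrices. -/
noncomputable def repOfMatrix (r : ∀ R, G.obj R →* Matrix κ κ R)
    (hr : ∀ {R S : SigmaAlg k σ} (f : R ⟶ S) (g : G.obj R),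
      r S ((G.map f).hom g) = (r R g).map (algHom f)) : G ⟶ sigmaGL (σ := σ) (κ → k) where
  app R := GrpCat.ofHom ((glMatrixEquiv R).symm.toMonoidHom.comp (r R).toHomUnits)
  naturality R S f := by
    refine GrpCat.hom_ext (MonoidHom.ext fun g => ?_)
    apply (glMatrixEquiv S).injective
    refine ((glMatrixEquiv S).apply_symm_apply _).trans ?_
    refine Eq.trans ?_ (glMatrixEquiv_map f ((glMatrixEquiv R).symm ((r R).toHomUnits g))).symm
    rw [MulEquiv.apply_symm_apply]
    exact Units.ext (hr f g)

section

variable (r : ∀ R, G.obj R →* Matrix κ κ R)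
    (hr : ∀ {R S : SigmaAlg k σ} (f : R ⟶ S) (g : G.obj R),
      r S ((G.map f).hom g) = (r R g).map (algHom f))

theorem glMatrixEquiv_repOfMatrix (R : SigmaAlg k σ) (g : G.obj R) :
    glMatrixEquiv R (((repOfMatrix r hr).app R).hom g) = (r R).toHomUnits g :=
  (glMatrixEquiv R).apply_symm_apply _

/-- A matrix representation is faithful if the entries of the universal matrix generate the
coordinate ring as a difference algebra. -/
theorem isFaithfulRep_repOfMatrix {A : SigmaAlg k σ}
    (e : (G ⋙ forget GrpCat.{u}).CorepresentableBy A)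
    (hgen : ∀ B : Subalgebra k A, (∀ i j, r A (groupPoint e (𝟙 A)) i j ∈ B) →
      (∀ b ∈ B, A.sig b ∈ B) → B = ⊤) :
    IsFaithfulRep (repOfMatrix r hr) := by
  let θ : glCoord σ κ ⟶ A := (glHomEquiv σ κ A).symm ((r A).toHomUnits (groupPoint e (𝟙 A)))
  have hθ : Function.Surjective (algHom θ) := by
    rw [← AlgHom.range_eq_top]
    refine hgen _ (fun i j => ?_) ?_
    · refine ⟨(glUniv σ κ).val i j, ?_⟩
      have h : glHomEquiv σ κ A θ = (r A).toHomUnits (groupPoint e (𝟙 A)) :=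
        (glHomEquiv σ κ A).apply_symm_apply _
      exact congrArg (fun U : (Matrix κ κ A)ˣ => U.val i j) h
    · rintro _ ⟨b, rfl⟩
      exact ⟨(glCoord σ κ).sig b, algHom_sig θ b⟩
  have hcomp : ∀ {R : SigmaAlg k σ} (ψ : A ⟶ R),
      glHomEquiv σ κ R (θ ≫ ψ) = (r R).toHomUnits (groupPoint e ψ) := by
    intro R ψ
    rw [glHomEquiv_comp, Equiv.apply_symm_apply]
    refine Units.ext ?_
    have h := groupPoint_comp e (𝟙 A) ψ
    rw [Category.id_comp] at h
    refine Eq.trans ?_ ((congrArg (r R) h).trans (hr ψ _)).symm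
    rfl
  have hcancel : ∀ {R : SigmaAlg k σ} {ψ χ : A ⟶ R}, θ ≫ ψ = θ ≫ χ → ψ = χ := by
    intro R ψ χ h
    refine hom_ext (AlgHom.ext fun a => ?_)
    obtain ⟨b, rfl⟩ := hθ a
    exact DFunLike.congr_fun (congrArg algHom h) b
  refine ⟨fun R g g' h => ?_, ?_⟩
  · have h1 : glMatrixEquiv R (((repOfMatrix r hr).app R).hom g) =
        glMatrixEquiv R (((repOfMatrix r hr).app R).hom g') := congrArg _ h
    rw [glMatrixEquiv_repOfMatrix, glMatrixEquiv_repOfMatrix, ← groupPoint_coordHom e g,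
      ← groupPoint_coordHom e g', ← hcomp, ← hcomp] at h1
    rw [← groupPoint_coordHom e g, hcancel ((glHomEquiv σ κ R).injective h1),
      groupPoint_coordHom]
  · refine ⟨glCoord σ κ, finitelySigmaGenerated_quotient_polynomial _ _,
      sigmaGLCorepresentableBy σ κ, RingHom.ker (algHom θ).toRingHom, fun a ha => ?_,
      fun R ψ => ⟨?_, fun h => ?_⟩⟩
    · exact (algHom_sig θ a).trans ((congrArg A.sig ha).trans (map_zero _))
    · rintro ⟨g, hg⟩ f hf
      have h1 : glHomEquiv σ κ R ψ = (r R).toHomUnits g := by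
        rw [← glMatrixEquiv_repOfMatrix r hr]
        exact ((glMatrixEquiv R).apply_symm_apply _).symm.trans
          (congrArg (glMatrixEquiv R) hg.symm)
      rw [← groupPoint_coordHom e g, ← hcomp] at h1
      rw [(glHomEquiv σ κ R).injective h1]
      exact (congrArg (algHom (coordHom e g)) hf).trans (map_zero _)
    · let χ₀ : A →ₐ[k] R := AlgHom.liftOfSurjective (algHom θ) hθ (algHom ψ) h
      have hχ₀ : ∀ b, χ₀ (algHom θ b) = algHom ψ b := fun b =>
        AlgHom.liftOfSurjective_apply _ _ _ _ b
      let χ : A ⟶ R := ofAlgHom χ₀ fun a => by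
        obtain ⟨b, rfl⟩ := hθ a
        rw [← algHom_sig, hχ₀, hχ₀, algHom_sig]
      have hχ : θ ≫ χ = ψ := hom_ext (AlgHom.ext hχ₀)
      refine ⟨groupPoint e χ, ?_⟩
      apply (glMatrixEquiv R).injective
      refine (glMatrixEquiv_repOfMatrix r hr R _).trans ?_
      rw [← hcomp, hχ]
      exact ((glMatrixEquiv R).apply_symm_apply _).symm

/-- An element stabilizes the line spanned by `w` iff `w` is an eigenvector of its matrix. -/
theorem mem_stabilizerPoints_repOfMatrix (w : κ → k) (R : SigmaAlg k σ) (g : G.obj R) :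
    g ∈ stabilizerPoints (repOfMatrix r hr) (Submodule.span k {w}) R ↔
      ∃ χ : R, (r R g).mulVec (fun i => algebraMap k R (w i)) =
        χ • fun i => algebraMap k R (w i) := by
  have hrepr : ∀ c : R, ((tensorBasis κ R).repr (c • (1 ⊗ₜ[k] w)) : κ → R) =
      c • fun i => algebraMap k R (w i) := by
    intro c
    ext i
    rw [map_smul, Finsupp.smul_apply, tensorBasis_repr_tmul, one_mul]
    rfl
  have hact : ((tensorBasis κ R).repr
      ((repAction (repOfMatrix r hr) R g).val (1 ⊗ₜ[k] w)) : κ → R) =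
      (r R g).mulVec fun i => algebraMap k R (w i) := by
    have h1 : (r R g) = LinearMap.toMatrix (tensorBasis κ R) (tensorBasis κ R)
        (repAction (repOfMatrix r hr) R g).val :=
      (congrArg Units.val (glMatrixEquiv_repOfMatrix r hr R g)).symm
    rw [h1, ← LinearMap.toMatrix_mulVec_repr (tensorBasis κ R) (tensorBasis κ R)]
    have h2 := hrepr 1
    rw [one_smul, one_smul] at h2
    rw [h2]
  have hspan : (Submodule.span k {w}).baseChange R = Submodule.span R {(1 : R) ⊗ₜ[k] w} := by
    rw [Submodule.baseChange_span, Set.image_singleton]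
    rfl
  have key : g ∈ stabilizerPoints (repOfMatrix r hr) (Submodule.span k {w}) R ↔
      ∃ χ : R, χ • ((1 : R) ⊗ₜ[k] w) = (repAction (repOfMatrix r hr) R g).val (1 ⊗ₜ[k] w) := by
    change (∀ x ∈ (Submodule.span k {w}).baseChange R,
      (repAction (repOfMatrix r hr) R g).val x ∈ (Submodule.span k {w}).baseChange R) ↔ _
    rw [hspan]
    constructor
    · intro h
      exact Submodule.mem_span_singleton.1 (h _ (Submodule.mem_span_singleton_self _))
    · rintro ⟨χ, h⟩ x hx
      obtain ⟨c, rfl⟩ := Submodule.mem_span_singleton.1 hx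
      rw [map_smul, ← h]
      exact Submodule.smul_mem _ _ (Submodule.smul_mem _ _ (Submodule.mem_span_singleton_self _))
  rw [key]
  refine exists_congr fun χ => ?_
  rw [← hact, ← hrepr χ]
  constructor
  · intro h
    rw [h]
  · intro h
    exact (tensorBasis κ R).repr.injective (DFunLike.coe_injective h.symm)

end

end MatrixRep

/-! ### A line whose stabilizer is a block triangular subgroup -/

section KroneckerPower

variable {R : Type*} [CommRing R] {ι a b : Type*}

/-- The Kronecker power of a matrix with tensor factors indexed by `a`. -/
def kronPow (a : Type*) [Fintype a] (M : Matrix ι ι R) : Matrix (a → ι) (a → ι) R :=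
  Matrix.of fun α β => ∏ i, M (α i) (β i)

theorem kronPow_apply [Fintype a] (M : Matrix ι ι R) (α β : a → ι) :
    kronPow a M α β = ∏ i, M (α i) (β i) := rfl

theorem kronPow_one [DecidableEq ι] [Fintype a] [DecidableEq a] : kronPow a (1 : Matrix ι ι R) = 1 := by
  ext α β
  simp only [kronPow_apply, Matrix.one_apply, Finset.prod_ite_zero, Finset.prod_const_one,
    Finset.mem_univ, true_imp_iff, funext_iff]

theorem kronPow_mul [Fintype ι] [Fintype a] [DecidableEq a] (M N : Matrix ι ι R) : kronPow a (M * N) = kronPow a M * kronPow a N := by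
  ext α β
  simp only [kronPow_apply, Matrix.mul_apply, ← Finset.prod_mul_distrib]
  rw [Finset.prod_univ_sum, Fintype.piFinset_univ]

/-- The direct sum of a matrix and its Kronecker power, as a multiplicative map. -/
def sumKronPow [Fintype ι] [DecidableEq ι] (a : Type*) [Fintype a] [DecidableEq a] :
    Matrix ι ι R →* Matrix (ι ⊕ (a → ι)) (ι ⊕ (a → ι)) R where
  toFun M := Matrix.fromBlocks M 0 0 (kronPow a M)
  map_one' := by rw [kronPow_one, Matrix.fromBlocks_one]
  map_mul' M N := by simp [Matrix.fromBlocks_multiply, kronPow_mul]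

theorem sumKronPow_apply [Fintype ι] [DecidableEq ι] [Fintype a] [DecidableEq a] (M : Matrix ι ι R) :
    sumKronPow a M = Matrix.fromBlocks M 0 0 (kronPow a M) := rfl

theorem sumKronPow_map [Fintype ι] [DecidableEq ι] [Fintype a] [DecidableEq a] {S : Type*} [CommRing S] (f : R →+* S) (M : Matrix ι ι R) :
    sumKronPow a (M.map f) = (sumKronPow a M).map f := by
  rw [sumKronPow_apply, sumKronPow_apply, Matrix.fromBlocks_map]
  congr 1
  · ext; simp
  · ext; simp
  · ext; simp [kronPow_apply]

variable [DecidableEq b]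

/-- The coordinates of the exterior product of the first basis vectors in the tensor power. -/
def wedgeVec (R : Type*) [CommRing R] (a b : Type*) [Fintype a] [DecidableEq a] [DecidableEq b]
    (α : a → a ⊕ b) : R :=
  ((1 : Matrix (a ⊕ b) (a ⊕ b) R).submatrix α Sum.inl).det

variable [Fintype a] [DecidableEq a]

theorem wedgeVec_inl : wedgeVec R a b Sum.inl = 1 := by
  rw [wedgeVec, Matrix.submatrix_one _ Sum.inl_injective, Matrix.det_one]

theorem map_wedgeVec {S : Type*} [CommRing S] (f : R →+* S) (α : a → a ⊕ b) :
    f (wedgeVec R a b α) = wedgeVec S a b α := by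
  rw [wedgeVec, wedgeVec, RingHom.map_det, RingHom.mapMatrix_apply, ← Matrix.submatrix_map,
    Matrix.map_one _ (map_zero f) (map_one f)]

variable [Fintype b]

theorem kronPow_mulVec_wedgeVec (M : Matrix (a ⊕ b) (a ⊕ b) R) (α : a → a ⊕ b) :
    (kronPow a M).mulVec (wedgeVec R a b) α = (M.submatrix α Sum.inl).det := by
  have h : ∀ β : a → a ⊕ b, wedgeVec R a b β = ∑ τ : Equiv.Perm a,
      ((Equiv.Perm.sign τ : ℤ) : R) * if β = fun i => Sum.inl (τ i) then 1 else 0 := by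
    intro β
    rw [wedgeVec, ← Matrix.det_transpose, Matrix.det_apply']
    refine Finset.sum_congr rfl fun τ _ => ?_
    congr 1
    simp only [Matrix.transpose_apply, Matrix.submatrix_apply, Matrix.one_apply,
      Finset.prod_ite_zero, Finset.prod_const_one, Finset.mem_univ, true_imp_iff, funext_iff]
  rw [← Matrix.det_transpose, Matrix.det_apply', Matrix.mulVec, dotProduct]
  simp only [h, Finset.mul_sum]
  rw [Finset.sum_comm]
  refine Finset.sum_congr rfl fun τ _ => ?_
  simp only [mul_ite, mul_one, mul_zero, Finset.sum_ite_eq', Finset.mem_univ, if_true,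
    kronPow_apply, Matrix.transpose_apply, Matrix.submatrix_apply]
  exact mul_comm _ _

/-- If the first block of columns of `M` has lower part zero, then `M` scales the exterior product
of the first basis vectors. Conversely, comparing the coordinates at `inl` and at `inl` with one
value changed shows that all minors obtained from the upper left block by replacing one row by a
row of the lower left block vanish; the upper left determinant being a unit, so does the lower left
block, by Cramer's rule. -/
theorem exists_kronPow_mulVec_wedgeVec_iff (M : (Matrix (a ⊕ b) (a ⊕ b) R)ˣ) :
    (∃ χ : R, (kronPow a M.val).mulVec (wedgeVec R a b) = χ • wedgeVec R a b) ↔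
      M.val.toBlocks₂₁ = 0 := by
  constructor
  · rintro ⟨χ, h⟩
    have hdet : χ = M.val.toBlocks₁₁.det := by
      have h1 := congrFun h Sum.inl
      rw [kronPow_mulVec_wedgeVec, Pi.smul_apply, wedgeVec_inl, smul_eq_mul, mul_one] at h1
      exact h1.symm
    have hunit : IsUnit χ := by
      have h1 : (kronPow a M.inv).mulVec ((kronPow a M.val).mulVec (wedgeVec R a b)) =
          wedgeVec R a b := by
        rw [Matrix.mulVec_mulVec, ← kronPow_mul, M.inv_val, kronPow_one, Matrix.one_mulVec]
      rw [h, Matrix.mulVec_smul] at h1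
      have h2 := congrFun h1 Sum.inl
      rw [wedgeVec_inl, Pi.smul_apply, smul_eq_mul] at h2
      exact .of_mul_eq_one _ h2
    ext j₀ i₁
    let c : a → R := fun i => M.val (Sum.inr j₀) (Sum.inl i)
    have hc : M.val.toBlocks₁₁.transpose.cramer c = 0 := by
      ext i₀
      rw [Matrix.cramer_transpose_apply]
      have h1 := congrFun h (Function.update Sum.inl i₀ (Sum.inr j₀))
      rw [kronPow_mulVec_wedgeVec, Pi.smul_apply] at h1
      have h2 : wedgeVec R a b (Function.update Sum.inl i₀ (Sum.inr j₀)) = 0 :=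
        Matrix.det_eq_zero_of_row_eq_zero i₀ fun j => by simp
      rw [h2, smul_zero] at h1
      refine Eq.trans (congrArg Matrix.det ?_) h1
      ext i j
      by_cases hi : i = i₀
      · subst hi
        simp [c]
      · simp [hi, Matrix.toBlocks₁₁]
    have h3 := Matrix.mulVec_cramer M.val.toBlocks₁₁.transpose c
    rw [hc, Matrix.mulVec_zero, Matrix.det_transpose, ← hdet] at h3
    have h4 := congrFun h3 i₁
    rw [Pi.zero_apply, Pi.smul_apply, smul_eq_mul] at h4
    exact (hunit.mul_right_eq_zero.1 h4.symm)
  · intro h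
    refine ⟨M.val.toBlocks₁₁.det, ?_⟩
    ext α
    rw [kronPow_mulVec_wedgeVec, Pi.smul_apply, smul_eq_mul, mul_comm, wedgeVec,
      ← Matrix.det_mul]
    congr 1
    ext i j
    rw [Matrix.mul_apply, Matrix.submatrix_apply]
    rcases hα : α i with l | l
    · simp [hα, Matrix.one_apply, Matrix.toBlocks₁₁]
    · have h5 : M.val (Sum.inr l) (Sum.inl j) = 0 := congrFun (congrFun h l) j
      simp [hα, h5]

end KroneckerPower

/-! ### Coaction matrices adapted to a Hopf ideal -/

section AdaptedCoaction

open Coalgebra HopfAlgebra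

variable {k A : Type*} [Field k] [CommRing A] [HopfAlgebra k A]

/-- A finitely `σ`-generated Hopf algebra is `σ`-generated by a finite family which generates a
Hopf subalgebra: the matrix coefficients of a finite-dimensional subcomodule containing the given
generators, together with their antipodes. -/
theorem exists_isHopfSubalgebra_generators {s : A →+* A} (F : Finset A)
    (hF : ∀ S : Subalgebra k A, (F : Set A) ⊆ S → (∀ b ∈ S, s b ∈ S) → S = ⊤) :
    ∃ (N : ℕ) (x : Fin N → A), IsHopfSubalgebra (Algebra.adjoin k (Set.range x)) ∧
      ∀ S : Subalgebra k A, Set.range x ⊆ S → (∀ b ∈ S, s b ∈ S) → S = ⊤ := by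
  obtain ⟨V, hVfin, hFV, hV⟩ := exists_finiteDimensional_subcomodule (k := k) F
  let bV := Module.finBasis k V
  let v : Fin (Module.finrank k V) → A := fun j => (bV j : A)
  have hspan : Submodule.span k (Set.range v) = V := by
    have : Set.range v = V.subtype '' Set.range bV := by rw [← Set.range_comp]; rfl
    rw [this, Submodule.span_image, bV.span_eq, Submodule.map_top, Submodule.range_subtype]
  have hv : LinearIndependent k v := bV.linearIndependent.map' V.subtype V.ker_subtype
  obtain ⟨ρ, hρ⟩ := exists_isCoactionMatrix v fun j l => by
    rw [hspan]; exact hV _ (bV j).2 l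
  let m := Fin (Module.finrank k V)
  let y : (m × m) ⊕ (m × m) → A :=
    Sum.elim (fun p => ρ p.1 p.2) fun p => antipode k (ρ p.1 p.2)
  let E := Fintype.equivFin ((m × m) ⊕ (m × m))
  have hrange : Set.range (y ∘ E.symm) = Set.range y := E.symm.surjective.range_comp y
  refine ⟨_, y ∘ E.symm, ?_⟩
  rw [hrange]
  have hρy : ∀ i j, ρ i j ∈ Set.range y := fun i j => ⟨Sum.inl (i, j), rfl⟩
  have hρy' : ∀ i j, antipode k (ρ i j) ∈ Set.range y := fun i j => ⟨Sum.inr (i, j), rfl⟩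
  have htmul : ∀ a ∈ Set.range y, ∀ b ∈ Set.range y, a ⊗ₜ[k] b ∈ (Algebra.TensorProduct.map
      (Algebra.adjoin k (Set.range y)).val (Algebra.adjoin k (Set.range y)).val).range :=
    fun a ha b hb => ⟨⟨a, Algebra.subset_adjoin ha⟩ ⊗ₜ ⟨b, Algebra.subset_adjoin hb⟩, rfl⟩
  refine ⟨isHopfSubalgebra_adjoin ?_ ?_, fun S hS hSs => hF S (fun f hf => ?_) hSs⟩
  · rintro _ ⟨p | p, rfl⟩
    · change comul (ρ p.1 p.2) ∈ _
      rw [hρ.comul_apply hv]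
      exact sum_mem fun l _ => htmul _ (hρy _ _) _ (hρy _ _)
    · change comul (antipode k (ρ p.1 p.2)) ∈ _
      rw [hρ.comul_antipode_apply hv]
      exact sum_mem fun l _ => htmul _ (hρy' _ _) _ (hρy' _ _)
  · rintro _ ⟨p | p, rfl⟩
    · exact Algebra.subset_adjoin (hρy' _ _)
    · change antipode k (antipode k (ρ p.1 p.2)) ∈ _
      rw [hρ.antipode_antipode hv]
      exact Algebra.subset_adjoin (hρy _ _)
  · have hf' := hFV hf
    rw [← hspan] at hf'
    refine (Submodule.span_le (p := Subalgebra.toSubmodule S)).2 ?_ hf'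
    rintro _ ⟨j, rfl⟩
    rw [hρ.eq_sum_counit_smul]
    exact sum_mem fun l _ => S.smul_mem (hS (hρy _ _)) _

/-- A finite-dimensional subspace has a basis whose first part lies in the kernel of a given linear
map and whose second part is mapped to a linearly independent family. -/
theorem exists_basis_adapted_ker {K M N : Type*} [Field K] [AddCommGroup M] [Module K M]
    [AddCommGroup N] [Module K N] (V : Submodule K M) [FiniteDimensional K V] (f : M →ₗ[K] N) :
    ∃ (p q : ℕ) (v : Fin p ⊕ Fin q → M), LinearIndependent K v ∧
      Submodule.span K (Set.range v) = V ∧ (∀ i, f (v (Sum.inl i)) = 0) ∧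
      LinearIndependent K (fun j => f (v (Sum.inr j))) := by
  let W : Submodule K V := LinearMap.ker (f ∘ₗ V.subtype)
  obtain ⟨C, hC⟩ := W.exists_isCompl
  let bW := Module.finBasis K W
  let bC := Module.finBasis K C
  let b := (bW.prod bC).map (Submodule.prodEquivOfIsCompl W C hC)
  have hbl : ∀ i, b (Sum.inl i) = (bW i : V) := fun i => by simp [b]
  have hbr : ∀ j, b (Sum.inr j) = (bC j : V) := fun j => by simp [b]
  refine ⟨_, _, fun l => (b l : M), b.linearIndependent.map' V.subtype V.ker_subtype, ?_,
    fun i => ?_, ?_⟩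
  · have : Set.range (fun l => (b l : M)) = V.subtype '' Set.range b := by
      rw [← Set.range_comp]; rfl
    rw [this, Submodule.span_image, b.span_eq, Submodule.map_top, Submodule.range_subtype]
  · beta_reduce
    rw [hbl]
    exact (bW i).2
  · have hker : LinearMap.ker (f ∘ₗ V.subtype ∘ₗ C.subtype) = ⊥ := by
      rw [eq_bot_iff]
      intro c hc
      have hcW : (c : V) ∈ W := hc
      exact Subtype.ext ((Submodule.mem_bot K).1 (hC.disjoint.le_bot ⟨hcW, c.2⟩))
    have h := bC.linearIndependent.map' _ hker
    simp only [hbr]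
    exact h

/-- A `σ`-stable Hopf ideal of a finitely `σ`-generated Hopf algebra is `σ`-generated by the lower
left block of a multiplicative matrix whose entries `σ`-generate the Hopf algebra. -/
theorem exists_multiplicative_matrix_adapted_ideal {σ : k →+* k} {s : A →+* A}
    (h : IsSemilinearHopfEnd σ s) (F : Finset A)
    (hF : ∀ S : Subalgebra k A, (F : Set A) ⊆ S → (∀ b ∈ S, s b ∈ S) → S = ⊤)
    (I : Ideal A) [I.IsHopfIdeal k] (hI : ∀ a ∈ I, s a ∈ I) :
    ∃ (p q : ℕ) (ρ : Matrix (Fin p ⊕ Fin q) (Fin p ⊕ Fin q) A),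
      (∀ i j, comul (R := k) (ρ i j) = ∑ l, ρ i l ⊗ₜ[k] ρ l j) ∧
      (∀ i j, counit (R := k) (ρ i j) = if i = j then 1 else 0) ∧
      (∀ S : Subalgebra k A, (∀ i j, ρ i j ∈ S) → (∀ b ∈ S, s b ∈ S) → S = ⊤) ∧
      (∀ j i, ρ (Sum.inr j) (Sum.inl i) ∈ I) ∧
      ∀ J : Ideal A, (∀ a ∈ J, s a ∈ J) → (∀ j i, ρ (Sum.inr j) (Sum.inl i) ∈ J) → I ≤ J := by
  classical
  obtain ⟨N, x, hx, hgen⟩ := exists_isHopfSubalgebra_generators F hF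
  obtain ⟨F', hF'I, hF'⟩ := exists_finset_generating_hopfIdeal h hx hgen I hI
  obtain ⟨V, hVfin, hFV, hV⟩ := exists_finiteDimensional_subcomodule (k := k) (F ∪ F')
  obtain ⟨p, q, v, hv, hspan, hmk, hvC⟩ :=
    exists_basis_adapted_ker V (Ideal.Quotient.mkₐ k I).toLinearMap
  obtain ⟨ρ, hρ⟩ := exists_isCoactionMatrix v fun j l => by
    rw [hspan]; exact hV _ (hspan ▸ Submodule.subset_span ⟨j, rfl⟩) l
  change ∀ i, Ideal.Quotient.mkₐ k I (v (Sum.inl i)) = 0 at hmk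
  have hvI : ∀ i, v (Sum.inl i) ∈ I := fun i => Ideal.Quotient.eq_zero_iff_mem.1 (hmk i)
  refine ⟨p, q, ρ, hρ.comul_apply hv, hρ.counit_apply hv, fun S hS hSs => ?_, fun j i => ?_,
    fun J hJs hJ => hF' J hJs fun f hf => ?_⟩
  · refine hF S (fun f hf => ?_) hSs
    have hf' := hFV (Finset.mem_coe.2 (Finset.mem_union_left _ hf))
    rw [← hspan] at hf'
    refine (Submodule.span_le (p := Subalgebra.toSubmodule S)).2 ?_ hf'
    rintro _ ⟨j, rfl⟩
    rw [hρ.eq_sum_counit_smul]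
    exact sum_mem fun l _ => S.smul_mem (hS _ _) _
  · -- The coaction on the part of the basis in `I` vanishes modulo `I`.
    have e : Algebra.TensorProduct.map (Ideal.Quotient.mkₐ k I) (Ideal.Quotient.mkₐ k I)
        (comul (R := k) (v (Sum.inl i))) = 0 := by
      have e1 : comul (R := k) (Ideal.Quotient.mkₐ k I (v (Sum.inl i))) =
        Algebra.TensorProduct.map (Ideal.Quotient.mkₐ k I) (Ideal.Quotient.mkₐ k I)
          (comul (R := k) (v (Sum.inl i))) := rfl
      rw [← e1, hmk, map_zero]
    rw [hρ, map_sum, Fintype.sum_sum_type] at e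
    simp only [Algebra.TensorProduct.map_tmul, hmk, zero_tmul, Finset.sum_const_zero,
      zero_add] at e
    have e2 := hvC.tmul_sum_injective (y := fun _ => 0) (e.trans (by simp))
    exact Ideal.Quotient.eq_zero_iff_mem.1 (congrFun e2 j)
  · have hvJ : ∀ i, v (Sum.inl i) ∈ J := by
      intro i
      rw [hρ.eq_sum_counit_smul, Fintype.sum_sum_type]
      refine add_mem (sum_mem fun l _ => ?_) (sum_mem fun l _ => ?_)
      · rw [Submodule.IsCoideal.counit_eq_zero (I := I.restrictScalars k) (hvI l), zero_smul]
        exact zero_mem _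
      · rw [Algebra.smul_def]
        exact J.mul_mem_left _ (hJ l i)
    have hf' := hFV (Finset.mem_coe.2 (Finset.mem_union_right F hf))
    rw [← hspan] at hf'
    obtain ⟨c, hc⟩ := (Submodule.mem_span_range_iff_exists_fun k).1 hf'
    have hcr : ∀ j, c (Sum.inr j) = 0 := by
      have e : Ideal.Quotient.mkₐ k I f = 0 := Ideal.Quotient.eq_zero_iff_mem.2 (hF'I hf)
      rw [← hc, map_sum, Fintype.sum_sum_type] at e
      simp only [map_smul, hmk, smul_zero, Finset.sum_const_zero, zero_add] at e
      exact Fintype.linearIndependent_iff.1 hvC _ e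
    rw [← hc, Fintype.sum_sum_type]
    simp only [hcr, zero_smul, Finset.sum_const_zero, add_zero]
    refine sum_mem fun i _ => ?_
    rw [Algebra.smul_def]
    exact J.mul_mem_left _ (hvJ i)

end AdaptedCoaction

/-! ### The stabilizer of a line -/

section Stabilizer

open SigmaAlg

variable {k : Type u} [Field k] {σ : k →+* k} {G : SigmaAlg k σ ⥤ GrpCat.{u}}
  {A : SigmaAlg k σ} (e : (G ⋙ forget GrpCat.{u}).CorepresentableBy A)

/-- The matrix of an element of `G R` obtained by specializing a multiplicative matrix over the
coordinate ring. -/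
noncomputable def specializeMatrix {ι : Type} [Fintype ι] [DecidableEq ι] (ρ : Matrix ι ι A)
    (hmul : ∀ i j, algHom (comulHom e) (ρ i j) = ∑ l, ρ i l ⊗ₜ[k] ρ l j)
    (hone : ∀ i j, algHom (counitHom e) (ρ i j) = if i = j then (1 : k) else 0)
    (R : SigmaAlg k σ) : G.obj R →* Matrix ι ι R where
  toFun g := ρ.map (algHom (coordHom e g))
  map_one' := by
    ext i j
    rw [groupPoint_one e R, coordHom_groupPoint, Matrix.map_apply]
    refine (congrArg (algebraMap k R) (hone i j)).trans ?_
    rw [Matrix.one_apply, apply_ite (algebraMap k R), map_one, map_zero]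
  map_mul' g g' := by
    have h : g * g' = groupPoint e (comulHom e ≫ tensorLift (coordHom e g) (coordHom e g')) := by
      rw [← groupPoint_mul, groupPoint_coordHom, groupPoint_coordHom]
    ext i j
    rw [h, coordHom_groupPoint, Matrix.map_apply, Matrix.mul_apply]
    refine (congrArg (algHom (tensorLift (coordHom e g) (coordHom e g'))) (hmul i j)).trans ?_
    refine (map_sum (algHom (tensorLift (coordHom e g) (coordHom e g'))) _ _).trans ?_
    rfl

theorem specializeMatrix_groupPoint {ι : Type} [Fintype ι] [DecidableEq ι] (ρ : Matrix ι ι A)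
    (hmul : ∀ i j, algHom (comulHom e) (ρ i j) = ∑ l, ρ i l ⊗ₜ[k] ρ l j)
    (hone : ∀ i j, algHom (counitHom e) (ρ i j) = if i = j then (1 : k) else 0)
    {R : SigmaAlg k σ} (ψ : A ⟶ R) :
    specializeMatrix e ρ hmul hone R (groupPoint e ψ) = ρ.map (algHom ψ) := by
  change ρ.map (algHom (coordHom e (groupPoint e ψ))) = _
  rw [coordHom_groupPoint]

theorem specializeMatrix_map {ι : Type} [Fintype ι] [DecidableEq ι] (ρ : Matrix ι ι A)
    (hmul : ∀ i j, algHom (comulHom e) (ρ i j) = ∑ l, ρ i l ⊗ₜ[k] ρ l j)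
    (hone : ∀ i j, algHom (counitHom e) (ρ i j) = if i = j then (1 : k) else 0)
    {R S : SigmaAlg k σ} (f : R ⟶ S) (g : G.obj R) :
    specializeMatrix e ρ hmul hone S ((G.map f).hom g) =
      (specializeMatrix e ρ hmul hone R g).map (algHom f) := by
  rw [← groupPoint_coordHom e g, ← groupPoint_comp, specializeMatrix_groupPoint,
    specializeMatrix_groupPoint]
  rfl

end Stabilizer

open SigmaAlg in
theorem mainTheorem7 {k : Type u} [Field k] (σ : k →+* k)
    (G : SigmaAlg k σ ⥤ GrpCat.{u}) (hG : IsSigmaAlgebraicGroup G)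
    (H : SigmaClosedSubgroup G) :
    ∃ (V : Type u) (_ : AddCommGroup V) (_ : Module k V) (_ : FiniteDimensional k V)
      (φ : G ⟶ sigmaGL V) (L : Submodule k V),
      IsFaithfulRep φ ∧ Module.finrank k L = 1 ∧
        ∀ R : SigmaAlg k σ, (H.points R : Set (G.obj R)) = stabilizerPoints φ L R := by
  obtain ⟨A, ⟨F, hF⟩, e, I, hI, hH⟩ := H.isSigmaClosed
  let _ := hopfAlgebraOfGroup e
  have _ : I.IsHopfIdeal k := isHopfIdeal_of_closedSubgroup e H I hI hH
  obtain ⟨p, q, ρ, hmul, hone, hgen, hρI, hρJ⟩ :=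
    exists_multiplicative_matrix_adapted_ideal (isSemilinearHopfEnd_sig e) F hF I hI
  -- `H` consists of the elements whose matrix has lower left block zero. The summand `r₀` of the
  -- representation makes it faithful, the tensor power contains the line.
  let r₀ := specializeMatrix e ρ hmul hone
  have hr₀ : ∀ {R : SigmaAlg k σ} (ψ : A ⟶ R), r₀ R (groupPoint e ψ) = ρ.map (algHom ψ) :=
    specializeMatrix_groupPoint e ρ hmul hone
  let r : ∀ R, G.obj R →* Matrix ((Fin p ⊕ Fin q) ⊕ (Fin p → Fin p ⊕ Fin q))
      ((Fin p ⊕ Fin q) ⊕ (Fin p → Fin p ⊕ Fin q)) R :=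
    fun R => (sumKronPow (Fin p)).comp (r₀ R)
  have hr : ∀ {R S : SigmaAlg k σ} (f : R ⟶ S) (g : G.obj R),
      r S ((G.map f).hom g) = (r R g).map (algHom f) := by
    intro R S f g
    exact (congrArg (sumKronPow (Fin p)) (specializeMatrix_map e ρ hmul hone f g)).trans
      (sumKronPow_map (algHom f).toRingHom _)
  let w : (Fin p ⊕ Fin q) ⊕ (Fin p → Fin p ⊕ Fin q) → k :=
    Sum.elim 0 (wedgeVec k (Fin p) (Fin q))
  have hw : w ≠ 0 := fun h => one_ne_zero
    ((wedgeVec_inl (R := k) (a := Fin p) (b := Fin q)).symm.trans (congrFun h (Sum.inr Sum.inl)))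
  refine ⟨_ → k, inferInstance, inferInstance, inferInstance, repOfMatrix r hr,
    Submodule.span k {w}, isFaithfulRep_repOfMatrix r hr e fun B hB hBs => hgen B ?_ hBs,
    finrank_span_singleton hw, fun R => ?_⟩
  · intro i j
    have h1 : r A (groupPoint e (𝟙 A)) (Sum.inl i) (Sum.inl j) = ρ i j :=
      congrArg (fun M : Matrix _ _ A => M i j) (hr₀ (𝟙 A))
    rw [← h1]
    exact hB (Sum.inl i) (Sum.inl j)
  · ext g
    have hmem : g ∈ H.points R ↔ (r₀ R g).toBlocks₂₁ = 0 := by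
      obtain ⟨ψ, rfl⟩ : ∃ ψ, groupPoint e ψ = g := ⟨_, groupPoint_coordHom e g⟩
      rw [hr₀]
      refine (hH R ψ).trans ⟨fun h => ?_, fun h => ?_⟩
      · ext j i
        exact h _ (hρI j i)
      · refine hρJ (RingHom.ker (algHom ψ).toRingHom) (fun a ha => ?_) fun j i => ?_
        · exact (algHom_sig ψ a).trans ((congrArg R.sig ha).trans (map_zero _))
        · exact congrFun (congrFun h j) i
    rw [mem_stabilizerPoints_repOfMatrix]
    refine hmem.trans ((exists_kronPow_mulVec_wedgeVec_iff ((r₀ R).toHomUnits g)).symm.trans ?_)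
    refine exists_congr fun χ => ?_
    have hwR : (fun i => algebraMap k R (w i)) =
        Sum.elim (0 : Fin p ⊕ Fin q → R) (wedgeVec R (Fin p) (Fin q)) := by
      ext i
      rcases i with i | α
      · exact map_zero _
      · exact map_wedgeVec (algebraMap k R) α
    rw [hwR]
    have hblock : (r R g).mulVec
        (Sum.elim (0 : Fin p ⊕ Fin q → R) (wedgeVec R (Fin p) (Fin q))) =
        Sum.elim (0 : Fin p ⊕ Fin q → R) ((kronPow (Fin p) (r₀ R g)).mulVec (wedgeVec R (Fin p) (Fin q))) := by
      refine (Matrix.fromBlocks_mulVec _ _ _ _ _).trans ?_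
      simp
    rw [hblock]
    constructor
    · intro h
      ext i
      rcases i with i | α
      · exact (mul_zero χ).symm
      · exact congrFun h α
    · intro h
      ext α
      exact congrFun h (Sum.inr α)
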